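/- Let $\alpha\in(0,\infty]$, $I=[0,\alpha)$ with Lebesgue measure $\mu$, and let $L^0$ be the set of Lebesgue measurable real functions on $I$. "Decreasing" means non-increasing, and functions in $L^0$ are identified when they are equal almost everywhere. Let $\varphi:[0,\infty)\to[0,\infty)$ be an $N$-function, i.e. $\varphi(0)=0$, $\varphi$ is convex and strictly increasing, $\lim_{t\to0+}\varphi(t)/t=0$ and $\lim_{t\to\infty}\varphi(t)/t=\infty$. Let $w$ be a positive decreasing function on $(0,\alpha)$ with $W(t)=\int_0^tw<\infty$ for all $t\in I$; if $\alpha=\infty$, assume moreover $W(\infty)=\int_0^\infty w=\infty$. For $f\in L^0$ put $f^*(t)=\inf\{\lambda>0:\mu\{s\in I:|f(s)|>\lambda\}\le t\}$, and write $g\prec w$ if $\int_0^tg^*\le\int_0^tw^*$ for all $t\in I$. Define $$P_{\varphi,w}(f)=\inf\Big\{\int_I\varphi\Big(\frac{f^*}{|g|}\Big)|g|:\ g\in L^0,\ g\prec w\Big\}\in[0,\infty],$$ where $\varphi(x/y)y$ for $y=0$ means $0$ if $x=0$ and $\infty$ if $x\ne0$, and let $\mathcal M_{\varphi,w}=\{f\in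 L^0:P_{\varphi,w}(f/\lambda)<\infty\text{ for some }\lambda>0\}$. Let $f\in\mathcal M_{\varphi,w}$ be (a.e. equal to) a non-negative decreasing function, i.e. $f=f^*$. For $0\le a<b\le\alpha$ put $R(a,b)=\int_a^bf\big/\int_a^bw$ if $b<\infty$, and $R(a,\infty)=\limsup_{t\to\infty}R(a,t)$. The interval $(a,b)$, $0\le a<b\le\alpha$, is a level interval of $f$ with respect to $w$ if $R(a,b)>0$ and $R(a,t)\le R(a,b)$ for all $t\in(a,b)$; it is maximal if it is not contained in a larger level interval. The maximal level intervals are pairwise disjoint; let $(a_n,b_n)$ be an enumeration of them. The level function $f^0$ of $f$ and the inverse level function $w^f$ of $w$ are $$f^0(t)=\begin{cases}R(a_n,b_n)\,w(t),&t\in(a_n,b_n),\\ f(t),&\text{otherwise,}\end{cases}\qquad w^f(t)=\begin{cases}f(t)/R(a_n,b_n),&t\in(a_n,b_n),\\ w(t),&\text{otherwise.}\end{cases}$$ Then $$P_{\varphi,w}(f)=\int_I\varphi\Big(\frac{f^0}{w}\Big)w=\int_I\varphi\Big(\frac{f}{w^f}\Big)w^f ,$$ as an equality in $[0,\infty]$.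 -/

import Mathlib

open Filter Topology MeasureTheory
open scoped ENNReal

namespace OrliczLorentz

noncomputable section

/-- The open interval `(a, b)` of the real half line, with extended nonnegative endpoints. -/
def ival (a b : ℝ≥0∞) : Set ℝ := {t : ℝ | a < ENNReal.ofReal t ∧ ENNReal.ofReal t < b}

/-- An `N`-function on `[0, ∞)`: `φ 0 = 0`, convex, strictly increasing, with `φ t / t → 0` as
`t → 0+` and `φ t / t → ∞` as `t → ∞`. Values of `φ` at negative arguments are never used. -/
structure IsNFunction (φ : ℝ → ℝ) : Prop where
  map_zero : φ 0 = 0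
  convexOn : ConvexOn ℝ (Set.Ici 0) φ
  strictMonoOn : StrictMonoOn φ (Set.Ici 0)
  tendsto_zero : Tendsto (fun t => φ t / t) (𝓝[>] 0) (𝓝 0)
  tendsto_atTop : Tendsto (fun t => φ t / t) atTop atTop

/-- The value `φ (x / y) * y`, with the convention that for `y = 0` it is `0` if `x = 0`
and `∞` if `x ≠ 0`, and with `φ ∞ = ∞`. -/
def persp (φ : ℝ → ℝ) (x y : ℝ≥0∞) : ℝ≥0∞ :=
  if y = 0 then (if x = 0 then 0 else ∞)
  else (if x / y = ∞ then ∞ else ENNReal.ofReal (φ (x / y).toReal)) * y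

/-- Distribution function of `f` on the interval `I = (0, α)`
(the endpoint `0` of `[0, α)` is a null set). -/
def distribution (α : ℝ≥0∞) (f : ℝ → ℝ) (l : ℝ≥0∞) : ℝ≥0∞ :=
  volume {t ∈ ival 0 α | l < ENNReal.ofReal |f t|}

/-- Decreasing rearrangement of `f` on the interval `I = (0, α)`. -/
def rearr (α : ℝ≥0∞) (f : ℝ → ℝ) (t : ℝ) : ℝ≥0∞ :=
  sInf {l : ℝ≥0∞ | 0 < l ∧ distribution α f l ≤ ENNReal.ofReal t}

/-- `∫ₐᵇ h` for `h ≥ 0`. -/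
def integ (h : ℝ → ℝ) (a b : ℝ≥0∞) : ℝ≥0∞ := ∫⁻ t in ival a b, ENNReal.ofReal (h t)

/-- A weight on `I`: positive, decreasing (on `t > 0`), and `W t = ∫₀ᵗ w < ∞` for `t ∈ I`. -/
structure IsWeight (α : ℝ≥0∞) (w : ℝ → ℝ) : Prop where
  pos : ∀ t ∈ ival 0 α, 0 < w t
  antitoneOn : AntitoneOn w (ival 0 α)
  integ_lt_top : ∀ t : ℝ≥0∞, t < α → integ w 0 t < ∞

/-- Submajorization `f ≺ g`: `∫₀ᵗ f* ≤ ∫₀ᵗ g*` for every `t ∈ I`. -/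
def Submaj (α : ℝ≥0∞) (f g : ℝ → ℝ) : Prop :=
  ∀ t : ℝ≥0∞, t < α → ∫⁻ s in ival 0 t, rearr α f s ≤ ∫⁻ s in ival 0 t, rearr α g s

/-- `f ∈ L⁰`: `f` is Lebesgue measurable on `I`. -/
def MemL0 (α : ℝ≥0∞) (f : ℝ → ℝ) : Prop := AEMeasurable f (volume.restrict (ival 0 α))

/-- The modular `P(f) = inf {∫_I φ(f*/|g|)|g| : g ∈ L⁰, g ≺ w}`. -/
def modP (α : ℝ≥0∞) (φ w f : ℝ → ℝ) : ℝ≥0∞ :=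
  ⨅ g ∈ {g : ℝ → ℝ | MemL0 α g ∧ Submaj α g w},
    ∫⁻ t in ival 0 α, persp φ (rearr α f t) (ENNReal.ofReal |g t|)

/-- The space `M_{φ,w}` generated by the modular `P`. -/
def MemM (α : ℝ≥0∞) (φ w f : ℝ → ℝ) : Prop :=
  MemL0 α f ∧ ∃ c : ℝ, 0 < c ∧ modP α φ w (fun t => f t / c) < ∞

/-- `R(a, b) = F(a, b) / W(a, b)` for `b < ∞`, and `R(a, ∞) = limsup_{t → ∞} R(a, t)`. -/
def ratio (w f : ℝ → ℝ) (a b : ℝ≥0∞) : ℝ≥0∞ :=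
  if b = ∞ then
    limsup (fun t : ℝ => integ f a (ENNReal.ofReal t) / integ w a (ENNReal.ofReal t)) atTop
  else integ f a b / integ w a b

/-- `(a, b) ⊆ I` is a level interval of `f` with respect to `w` (degenerate if `b = ∞`). -/
def IsLevelInterval (α : ℝ≥0∞) (w f : ℝ → ℝ) (a b : ℝ≥0∞) : Prop :=
  a < b ∧ b ≤ α ∧ 0 < ratio w f a b ∧
    ∀ t : ℝ≥0∞, a < t → t < b → ratio w f a t ≤ ratio w f a b

/-- A level interval that is not contained in a larger one. -/
def IsMaxLevelInterval (α : ℝ≥0∞) (w f : ℝ → ℝ) (a b : ℝ≥0∞) : Prop :=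
  IsLevelInterval α w f a b ∧
    ∀ a' b' : ℝ≥0∞, IsLevelInterval α w f a' b' → a' ≤ a → b ≤ b' → a' = a ∧ b' = b

/-- `t` lies in the maximal level interval `(p.1, p.2)`. -/
def InMaxLevelInterval (α : ℝ≥0∞) (w f : ℝ → ℝ) (t : ℝ) (p : ℝ≥0∞ × ℝ≥0∞) : Prop :=
  IsMaxLevelInterval α w f p.1 p.2 ∧ t ∈ ival p.1 p.2

open Classical in
/-- The level function `f⁰` of `f` with respect to `w`: `R(a, b) * w t` if `t` lies in a maximal
level interval `(a, b)` (these are pairwise disjoint), and `f t` otherwise. -/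
def levelFun (α : ℝ≥0∞) (w f : ℝ → ℝ) (t : ℝ) : ℝ≥0∞ :=
  if h : ∃ p, InMaxLevelInterval α w f t p then
    ratio w f h.choose.1 h.choose.2 * ENNReal.ofReal (w t)
  else ENNReal.ofReal (f t)

open Classical in
/-- The inverse level function `w^f` of `w` with respect to `f`: `f t / R(a, b)` if `t` lies in a
maximal level interval `(a, b)`, and `w t` otherwise. -/
def invLevelFun (α : ℝ≥0∞) (w f : ℝ → ℝ) (t : ℝ) : ℝ≥0∞ :=
  if h : ∃ p, InMaxLevelInterval α w f t p then
    ENNReal.ofReal (f t) / ratio w f h.choose.1 h.choose.2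
  else ENNReal.ofReal (w t)

end

end OrliczLorentz

/-! Let `F` and `W` be the primitives of `f` and `w`, and consider the curve `t ↦ (W t, F t)`. The
condition `R(a,t) ≤ R(a,b)` says that the curve stays below its chord over `(a,b)`, so level
intervals are chords of positive slope lying above the curve, and the maximal ones are those whose
endpoints lie strictly under no such chord (contact points). In effect `f⁰ / w` is the slope of the
least concave majorant of the curve, hence decreasing (`slopeFun_antitoneOn`).

Upper bound. The function `w^f` is decreasing (`invLevelFun_antitoneOn`), and `w^f ≺ w` because the
curve lies below its chords (`lintegral_invLevelFun_le`), so it competes in the infimum. On a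
maximal level interval of ratio `m` one has `∫ f = m ∫ w`, so `φ(m) f / m` and `φ(m) w` have equal
integrals there. Thus the two integrals of the theorem agree (`lintegral_persp_eq`), and the modular
is at most their common value.

Lower bound. Let `g ≺ w`, `v = f⁰ / w`, let `D` be a subgradient of `φ`, and put `ψ(v) = v D(v) -
φ(v)`. Young's inequality gives `D(v) f ≤ φ(f/|g|)|g| + ψ(v)|g|`. As `ψ(v)` is decreasing, Hardy's
lemma gives `∫ ψ(v)|g| ≤ ∫ ψ(v) w`. As `v` is constant on maximal level intervals, `∫ D(v) f = ∫ v
D(v) w`. Subtracting `∫ ψ(v) w` leaves `∫ φ(v) w ≤ ∫ φ(f/|g|)|g|`.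

The subtraction needs finiteness, so `v` is truncated at `n` and `I` is cut at a finite contact
point (`lintegral_min_le`). If a maximal level interval is unbounded, suitable cuts may not exist,
but then the right side is infinite for every `g ≺ w` (`lintegral_persp_eq_top`). Membership in
`M_{φ,w}` enters through `F ≤ A + B W`, which makes all ratios at infinity finite. -/

namespace OrliczLorentz

/-! ### Chords and contact points of the curve of primitives -/

/-- Primitives `W`, `H` of a weight and of a decreasing function on `(0, α)`, where `ρ` is the
upper limit of `H / W` at `∞` when `α = ∞`. -/
structure PrimitivePair (α : ℝ≥0∞) (W H : ℝ≥0∞ → ℝ) (ρ : ℝ) : Prop where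
  strictMonoOn : StrictMonoOn W {x | x ≤ α ∧ x < ∞}
  monotoneOn : MonotoneOn H {x | x ≤ α ∧ x < ∞}
  continuousOn_left : ContinuousOn W {x | x ≤ α ∧ x < ∞}
  continuousOn_right : ContinuousOn H {x | x ≤ α ∧ x < ∞}
  unbounded : α = ∞ → ∀ M : ℝ, ∃ x < ∞, ∀ y, x ≤ y → y < ∞ → M ≤ W y
  upper : α = ∞ → ∀ m, ρ < m → ∃ x < ∞, ∀ y, x ≤ y → y < ∞ → H y ≤ m * W y
  lower : α = ∞ → ∀ m, m < ρ → ∀ x < ∞, ∃ y, x ≤ y ∧ y < ∞ ∧ m * W y < H y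

/-- On `(a, b)` the curve `(W, H)` stays below its chord, which has slope `m > 0`. -/
structure IsChord (α : ℝ≥0∞) (W H : ℝ≥0∞ → ℝ) (ρ : ℝ) (a b : ℝ≥0∞) (m : ℝ) : Prop where
  lt : a < b
  le : b ≤ α
  pos : 0 < m
  below : ∀ s, a ≤ s → s ≤ b → s < ∞ → H s - m * W s ≤ H a - m * W a
  eq : b < ∞ → H b - m * W b = H a - m * W a
  eq_top : b = ∞ → m = ρ

/-- The point `p` lies under no chord. -/
def IsContact (α : ℝ≥0∞) (W H : ℝ≥0∞ → ℝ) (ρ : ℝ) (p : ℝ≥0∞) : Prop :=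
  ∀ c d m, IsChord α W H ρ c d m → c < p → p < d → False

section

variable {α : ℝ≥0∞} {W H : ℝ≥0∞ → ℝ} {ρ : ℝ}

theorem isContact_zero : IsContact α W H ρ 0 := fun _ _ _ _ h _ => not_lt_bot h

theorem isContact_right : IsContact α W H ρ α := fun _ _ _ h _ h' => (h'.trans_le h.le).false

/-- The complement is a union of open intervals, one for each chord. Closedness provides nearest
contact points on both sides of a given point. -/
theorem isClosed_isContact : IsClosed {p | IsContact α W H ρ p} := by
  have : {p | IsContact α W H ρ p}ᶜ =
      ⋃ (c : ℝ≥0∞) (d : ℝ≥0∞) (m : ℝ) (_ : IsChord α W H ρ c d m), Set.Ioo c d := by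
    ext p
    simp only [IsContact, Set.mem_compl_iff, Set.mem_ofPred_eq, Set.mem_iUnion, Set.mem_Ioo]
    push Not
    constructor
    · rintro ⟨c, d, m, h, h1, h2, -⟩
      exact ⟨c, d, m, h, h1, h2⟩
    · rintro ⟨c, d, m, h, h1, h2⟩
      exact ⟨c, d, m, h, h1, h2, trivial⟩
  rw [← isOpen_compl_iff, this]
  exact isOpen_iUnion fun c => isOpen_iUnion fun d => isOpen_iUnion fun m =>
    isOpen_iUnion fun _ => isOpen_Ioo

theorem PrimitivePair.continuousOn_sub (hP : PrimitivePair α W H ρ) (m : ℝ) {a b : ℝ≥0∞}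
    (hb : b ≤ α) (hb' : b < ∞) : ContinuousOn (fun s => H s - m * W s) (Set.Icc a b) := by
  have hs : Set.Icc a b ⊆ {x | x ≤ α ∧ x < ∞} :=
    fun x hx => ⟨hx.2.trans hb, hx.2.trans_lt hb'⟩
  exact (hP.continuousOn_right.mono hs).sub
    (continuousOn_const.mul (hP.continuousOn_left.mono hs))

theorem PrimitivePair.lt_of_lt (hP : PrimitivePair α W H ρ) {a b : ℝ≥0∞} (hab : a < b)
    (hb : b ≤ α) (hb' : b < ∞) : W a < W b :=
  hP.strictMonoOn ⟨hab.le.trans hb, hab.trans hb'⟩ ⟨hb, hb'⟩ hab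

theorem PrimitivePair.le_of_le (hP : PrimitivePair α W H ρ) {a b : ℝ≥0∞} (hab : a ≤ b)
    (hb : b ≤ α) (hb' : b < ∞) : H a ≤ H b :=
  hP.monotoneOn ⟨hab.trans hb, hab.trans_lt hb'⟩ ⟨hb, hb'⟩ hab

/-- The curve `(W, H)` is concave at a contact point. -/
theorem IsContact.concave (hP : PrimitivePair α W H ρ) {a p b : ℝ≥0∞}
    (hp : IsContact α W H ρ p) (hap : a < p) (hpb : p < b) (hb : b ≤ α) (hb' : b < ∞) :
    (H b - H p) * (W p - W a) ≤ (H p - H a) * (W b - W p) := by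
  by_contra! hcon
  have hp' : p < ∞ := hpb.trans hb'
  have hpα : p ≤ α := hpb.le.trans hb
  have h1 : 0 < W p - W a := sub_pos.2 (hP.lt_of_lt hap hpα hp')
  have h2 : 0 < W b - W p := sub_pos.2 (hP.lt_of_lt hpb hb hb')
  -- If concavity fails at `p`, a slope `c` fits strictly between the two secants, so `H - c W` is
  -- smaller at `p` than at `a` and at `b`. Its maximisers `a'` and `b'` on the two sides of `p` are
  -- therefore different from `p`, and a chord over `p` can be built from them.
  obtain ⟨c, hc1, hc2⟩ := exists_between ((div_lt_div_iff₀ h1 h2).2 hcon)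
  rw [div_lt_iff₀ h1] at hc1
  rw [lt_div_iff₀ h2] at hc2
  have hHp : 0 ≤ H p - H a := sub_nonneg.2 (hP.le_of_le hap.le hpα hp')
  have hc : 0 < c := by
    by_contra! h
    nlinarith
  obtain ⟨a', ha', ha'max⟩ := isCompact_Icc.exists_isMaxOn (Set.nonempty_Icc.2 hap.le)
    (hP.continuousOn_sub c (a := a) hpα hp')
  obtain ⟨b', hb1, hb'max⟩ := isCompact_Icc.exists_isMaxOn (Set.nonempty_Icc.2 hpb.le)
    (hP.continuousOn_sub c (a := p) hb hb')
  rw [isMaxOn_iff] at ha'max hb'max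
  have ga : H a - c * W a ≤ H a' - c * W a' := ha'max a ⟨le_rfl, hap.le⟩
  have gb : H b - c * W b ≤ H b' - c * W b' := hb'max b ⟨hpb.le, le_rfl⟩
  have hsA : Set.Icc a p ⊆ {x | x ≤ α ∧ x < ∞} :=
    fun x hx => ⟨hx.2.trans hpα, hx.2.trans_lt hp'⟩
  have hsB : Set.Icc p b ⊆ {x | x ≤ α ∧ x < ∞} :=
    fun x hx => ⟨hx.2.trans hb, hx.2.trans_lt hb'⟩
  have ha'p : a' < p := by
    rcases ha'.2.lt_or_eq with h | h
    · exact h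
    · subst h; linarith
  have hpb' : p < b' := by
    rcases hb1.1.lt_or_eq with h | h
    · exact h
    · subst h; linarith
  have hb'α : b' ≤ α := hb1.2.trans hb
  have hb'top : b' < ∞ := hb1.2.trans_lt hb'
  -- The lower of the two maxima is kept as an endpoint and the line through it is tilted until it
  -- supports the curve on the other side of `p`. Here `a'` is kept and `d` maximises the slope seen
  -- from it, which is at least `c`; in the other case `b'` is kept and the slope is minimised.
  rcases le_total (H a' - c * W a') (H b' - c * W b') with hab | hab
  · have hpos : ∀ s ∈ Set.Icc p b, 0 < W s - W a' := fun s hs =>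
      sub_pos.2 (hP.lt_of_lt (ha'p.trans_le hs.1) (hs.2.trans hb) (hs.2.trans_lt hb'))
    obtain ⟨d, hd, hdmax⟩ := isCompact_Icc.exists_isMaxOn (Set.nonempty_Icc.2 hpb.le)
      (((hP.continuousOn_right.mono hsB).sub (continuousOn_const (c := H a'))).div
        ((hP.continuousOn_left.mono hsB).sub (continuousOn_const (c := W a')))
        (fun s hs => (hpos s hs).ne'))
    simp only [isMaxOn_iff, Pi.div_apply, Pi.sub_apply] at hdmax
    set m := (H d - H a') / (W d - W a') with hm
    have hmd : H d - H a' = m * (W d - W a') := by rw [hm, div_mul_cancel₀ _ (hpos d hd).ne']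
    have hcm : c ≤ m := by
      refine le_trans ?_ (hdmax b' hb1)
      rw [le_div_iff₀ (hpos b' hb1)]
      linarith
    have hpd : p < d := by
      rcases hd.1.lt_or_eq with h | h
      · exact h
      · subst h
        have := hpos _ hd
        nlinarith
    refine hp a' d m ⟨ha'p.trans hpd, hd.2.trans hb, hc.trans_le hcm, ?_, fun _ => by linarith,
      fun h => absurd h (hd.2.trans_lt hb').ne⟩ ha'p hpd
    intro s hs1 hs2 hs3
    rcases le_total s p with hsp | hsp
    · have e1 := ha'max s ⟨ha'.1.trans hs1, hsp⟩
      have e2 : W a' ≤ W s := hP.strictMonoOn.monotoneOn (hsA ha')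
        ⟨hsp.trans hpα, hs3⟩ hs1
      nlinarith
    · have e := hdmax s ⟨hsp, hs2.trans hd.2⟩
      rw [div_le_iff₀ (hpos s ⟨hsp, hs2.trans hd.2⟩)] at e
      linarith
  · have hpos : ∀ s ∈ Set.Icc a p, 0 < W b' - W s := fun s hs =>
      sub_pos.2 (hP.lt_of_lt (hs.2.trans_lt hpb') hb'α hb'top)
    obtain ⟨d, hd, hdmin⟩ := isCompact_Icc.exists_isMinOn (Set.nonempty_Icc.2 hap.le)
      (((continuousOn_const (c := H b')).sub (hP.continuousOn_right.mono hsA)).div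
        ((continuousOn_const (c := W b')).sub (hP.continuousOn_left.mono hsA))
        (fun s hs => (hpos s hs).ne'))
    simp only [isMinOn_iff, Pi.div_apply, Pi.sub_apply] at hdmin
    set m := (H b' - H d) / (W b' - W d) with hm
    have hmd : H b' - H d = m * (W b' - W d) := by rw [hm, div_mul_cancel₀ _ (hpos d hd).ne']
    have hcm : m ≤ c := by
      refine le_trans (hdmin a' ha') ?_
      rw [div_le_iff₀ (hpos a' ha')]
      linarith
    have hWpb : 0 < W b' - W p := hpos p ⟨hap.le, le_rfl⟩
    have hdp : d < p := by
      rcases hd.2.lt_or_eq with h | h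
      · exact h
      · subst h
        nlinarith
    have hm0 : 0 < m := by
      refine div_pos ?_ (hpos d hd)
      have : H d ≤ H p := hP.le_of_le hd.2 hpα hp'
      nlinarith
    refine hp d b' m ⟨hdp.trans hpb', hb'α, hm0, ?_, fun _ => by linarith,
      fun h => absurd h hb'top.ne⟩ hdp hpb'
    intro s hs1 hs2 hs3
    rcases le_total s p with hsp | hsp
    · have e := hdmin s ⟨hd.1.trans hs1, hsp⟩
      rw [le_div_iff₀ (hpos s ⟨hd.1.trans hs1, hsp⟩)] at e
      linarith
    · have e1 := hb'max s ⟨hsp, hs2.trans hb1.2⟩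
      have e2 : W s ≤ W b' := hP.strictMonoOn.monotoneOn ⟨hs2.trans hb'α, hs3⟩
        ⟨hb'α, hb'top⟩ hs2
      nlinarith

/-- A first maximum of `H - m W` lies under no chord. -/
theorem IsChord.not_first_max (hP : PrimitivePair α W H ρ) {a b c d x : ℝ≥0∞} {m m' : ℝ}
    (hx : ∀ s, a ≤ s → s ≤ b → s < ∞ → H s - m * W s ≤ H x - m * W x)
    (hx' : ∀ s, a ≤ s → s < x → H s - m * W s < H x - m * W x)
    (h : IsChord α W H ρ c d m') (hcx : c < x) (hxd : x < d) (hac : a ≤ c) (hdb : d ≤ b)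
    (hd : d = ∞ → ρ ≤ m) : False := by
  have hxt : x < ∞ := hxd.trans_le le_top
  have hxα : x ≤ α := hxd.le.trans h.le
  have h1 := h.below x hcx.le hxd.le hxt
  have h2 := hx' c hac hcx
  have h3 := hP.lt_of_lt hcx hxα hxt
  -- Between `c` and `x` the curve rises by more than `m` times the rise of `W`, but by at most `m'`
  -- times. Beyond `x` the chord of slope `m' > m` would then carry `H - m W` above its maximum.
  have hmm : m < m' := by
    by_contra! hle
    nlinarith
  rcases eq_or_ne d ∞ with hdt | hdt
  · have := h.eq_top hdt
    have := hd hdt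
    linarith
  · have hdt' := lt_top_iff_ne_top.2 hdt
    have h4 := h.eq hdt'
    have h5 := hx d (hac.trans h.lt.le) hdb hdt'
    have h6 := hP.lt_of_lt hxd h.le hdt'
    nlinarith

/-- A continuous function on a compact interval has a first maximum. -/
theorem exists_first_max {G : ℝ≥0∞ → ℝ} {a b : ℝ≥0∞} (hab : a ≤ b)
    (hG : ContinuousOn G (Set.Icc a b)) :
    ∃ x ∈ Set.Icc a b, (∀ s ∈ Set.Icc a b, G s ≤ G x) ∧ ∀ s, a ≤ s → s < x → G s < G x := by
  obtain ⟨y, hy, hmax⟩ := isCompact_Icc.exists_isMaxOn (Set.nonempty_Icc.2 hab) hG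
  rw [isMaxOn_iff] at hmax
  have hcl : IsClosed (Set.Icc a b ∩ G ⁻¹' Set.Ici (G y)) :=
    hG.preimage_isClosed_of_isClosed isClosed_Icc isClosed_Ici
  obtain ⟨x, hx, hleast⟩ := hcl.isCompact.exists_isLeast ⟨y, hy, Set.mem_preimage.2 (Set.mem_Ici.2 le_rfl)⟩
  refine ⟨x, hx.1, fun s hs => (hmax s hs).trans hx.2, fun s hs hsx => ?_⟩
  by_contra! hle
  exact absurd (hleast ⟨⟨hs, hsx.le.trans hx.1.2⟩, le_trans hx.2 hle⟩) hsx.not_ge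

/-- A point which is no contact point lies under a chord whose endpoints are contact points. -/
theorem exists_isChord_of_not_isContact (hP : PrimitivePair α W H ρ) {p : ℝ≥0∞}
    (hp : ¬ IsContact α W H ρ p) :
    ∃ a b m, IsChord α W H ρ a b m ∧ a < p ∧ p < b ∧ IsContact α W H ρ a ∧
      IsContact α W H ρ b := by
  set K := {p | IsContact α W H ρ p} with hK
  have hKc : IsClosed K := isClosed_isContact
  obtain ⟨c, d, m₀, h₀, hcp, hpd⟩ : ∃ c d m, IsChord α W H ρ c d m ∧ c < p ∧ p < d := by
    by_contra! hcon
    exact hp fun c d m h h1 h2 => absurd h2 (hcon c d m h h1).not_gt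
  obtain ⟨a, ⟨haK, hap⟩, hamax⟩ := (hKc.inter (isClosed_Iic (a := p))).isCompact.exists_isGreatest
    ⟨0, isContact_zero, Set.mem_Iic.2 zero_le⟩
  obtain ⟨b, ⟨hbK, hpb⟩, hbmin⟩ := (hKc.inter (isClosed_Ici (a := p))).isCompact.exists_isLeast
    ⟨α, isContact_right, Set.mem_Ici.2 (hpd.le.trans h₀.le)⟩
  have hap : a < p := lt_of_le_of_ne hap fun h => hp (h ▸ haK)
  have hpb : p < b := lt_of_le_of_ne hpb fun h => hp (h ▸ hbK)
  have hbα : b ≤ α := hbmin ⟨isContact_right, hpd.le.trans h₀.le⟩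
  -- The points `a` and `b` are the nearest contact points around `p`. No chord passes over a
  -- contact point, so every chord over a point of `(a, b)` stays inside `[a, b]`.
  have hin : ∀ x, a < x → x < b → ∃ c d m, IsChord α W H ρ c d m ∧ c < x ∧ x < d ∧ a ≤ c ∧
      d ≤ b := by
    intro x hax hxb
    have hx : ¬ IsContact α W H ρ x := fun hx => by
      rcases le_total x p with h | h
      · exact absurd (hamax ⟨hx, h⟩) hax.not_ge
      · exact absurd (hbmin ⟨hx, h⟩) hxb.not_ge
    obtain ⟨c, d, m, h, h1, h2⟩ : ∃ c d m, IsChord α W H ρ c d m ∧ c < x ∧ x < d := by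
      by_contra! hcon
      exact hx fun c d m h h1 h2 => absurd h2 (hcon c d m h h1).not_gt
    refine ⟨c, d, m, h, h1, h2, ?_, ?_⟩
    · by_contra! hlt
      exact haK c d m h hlt (hax.trans h2)
    · by_contra! hlt
      exact hbK c d m h (h1.trans hxb) hlt
  have hac : a ≤ c := by
    by_contra! hlt
    exact haK c d m₀ h₀ hlt (hap.trans hpd)
  have hdb : d ≤ b := by
    by_contra! hlt
    exact hbK c d m₀ h₀ (hcp.trans hpb) hlt
  have hinc : d < ∞ → H a < H d := fun hd => by
    have h1 := h₀.eq hd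
    have h2 := hP.lt_of_lt h₀.lt h₀.le hd
    have h3 := hP.le_of_le hac (h₀.lt.le.trans h₀.le) (h₀.lt.trans hd)
    nlinarith [h₀.pos]
  rcases eq_or_ne b ∞ with hbt | hbt
  · subst hbt
    have hα : α = ∞ := top_le_iff.1 hbα
    have hat : a < ∞ := hap.trans hpb
    have hbelow : ∀ s, a ≤ s → s ≤ ∞ → s < ∞ → H s - ρ * W s ≤ H a - ρ * W a := by
      intro s₀ has₀ _ hs₀
      by_contra! hlt
      have has₀ : a < s₀ := lt_of_le_of_ne has₀ fun h => by subst h; exact hlt.false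
      have hW₀ := hP.lt_of_lt has₀ (hα ▸ le_top) hs₀
      -- For slope `ρ` itself `H - ρ W` need not attain its maximum on an unbounded interval. For
      -- `m` slightly above `ρ` it is eventually below its value at `a`, and the excess at `s₀`
      -- survives.
      obtain ⟨m, hm1, hm2⟩ : ∃ m, ρ < m ∧ H a - m * W a < H s₀ - m * W s₀ := by
        obtain ⟨m, hm1, hm2⟩ := exists_between
          (show ρ < (H s₀ - H a) / (W s₀ - W a) by
            rw [lt_div_iff₀ (by linarith)]; linarith)
        rw [lt_div_iff₀ (by linarith)] at hm2
        exact ⟨m, hm1, by linarith⟩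
      obtain ⟨m₁, hm₁, hm₁'⟩ := exists_between hm1
      obtain ⟨x₁, hx₁, hx₁'⟩ := hP.upper hα m₁ hm₁
      obtain ⟨x₂, hx₂, hx₂'⟩ := hP.unbounded hα (-(H a - m * W a) / (m - m₁))
      set X := max s₀ (max x₁ x₂) with hX
      have hXt : X < ∞ := max_lt hs₀ (max_lt hx₁ hx₂)
      have hbig : ∀ y, X ≤ y → y < ∞ → H y - m * W y ≤ H a - m * W a := by
        intro y hy hyt
        have e1 := hx₁' y ((le_max_left _ _).trans ((le_max_right _ _).trans hy)) hyt
        have e2 := hx₂' y ((le_max_right _ _).trans ((le_max_right _ _).trans hy)) hyt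
        rw [div_le_iff₀ (by linarith)] at e2
        linarith
      obtain ⟨x, hx, hxmax, hxfirst⟩ := exists_first_max (has₀.le.trans (le_max_left _ _))
        (hP.continuousOn_sub m (a := a) (b := X) (hα ▸ le_top) hXt)
      have hxa : H a - m * W a < H x - m * W x :=
        hm2.trans_le (hxmax s₀ ⟨has₀.le, le_max_left _ _⟩)
      have hax : a < x := lt_of_le_of_ne hx.1 fun h => by subst h; exact hxa.false
      obtain ⟨c', d', m', h', h1, h2, h3, h4⟩ := hin x hax (hx.2.trans_lt hXt)
      refine IsChord.not_first_max hP (m := m) (fun s hs _ hst => ?_) hxfirst h' h1 h2 h3 h4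
        fun _ => hm1.le
      rcases le_total s X with h | h
      · exact hxmax s ⟨hs, h⟩
      · exact (hbig s h hst).trans hxa.le
    refine ⟨a, ∞, ρ, ⟨hap.trans hpb, hbα, ?_, hbelow, fun h => absurd rfl h.ne,
      fun _ => rfl⟩, hap, hpb, haK, hbK⟩
    rcases eq_or_ne d ∞ with hd | hd
    · exact h₀.eq_top hd ▸ h₀.pos
    · have hd := lt_top_iff_ne_top.2 hd
      have h1 := hinc hd
      have h2 := hbelow d (hac.trans h₀.lt.le) le_top hd
      have h3 := hP.lt_of_lt (hac.trans_lt h₀.lt) h₀.le hd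
      by_contra! hρ
      nlinarith
  · have hbt := lt_top_iff_ne_top.2 hbt
    have hW := sub_pos.2 (hP.lt_of_lt (hap.trans hpb) hbα hbt)
    set m := (H b - H a) / (W b - W a) with hm
    have hmb : H b - H a = m * (W b - W a) := by rw [hm, div_mul_cancel₀ _ hW.ne']
    have hH : H a < H b := (hinc (hdb.trans_lt hbt)).trans_le (hP.le_of_le hdb hbα hbt)
    refine ⟨a, b, m, ⟨hap.trans hpb, hbα, div_pos (sub_pos.2 hH) hW, ?_, fun _ => by linarith,
      fun h => absurd h hbt.ne⟩, hap, hpb, haK, hbK⟩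
    intro s₀ has₀ hs₀b _
    by_contra! hlt
    -- A point above the line would put the first maximum of `H - m W` strictly inside `(a, b)`,
    -- hence under a chord, which is impossible.
    obtain ⟨x, hx, hxmax, hxfirst⟩ := exists_first_max (has₀.trans hs₀b)
      (hP.continuousOn_sub m (a := a) hbα hbt)
    have hxa := hlt.trans_le (hxmax s₀ ⟨has₀, hs₀b⟩)
    have hax : a < x := lt_of_le_of_ne hx.1 fun h => by subst h; exact hxa.false
    have hxb : x < b := lt_of_le_of_ne hx.2 fun h => by subst h; linarith
    obtain ⟨c', d', m', h', h1, h2, h3, h4⟩ := hin x hax hxb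
    exact IsChord.not_first_max hP (m := m) (fun s hs hs' _ => hxmax s ⟨hs, hs'⟩) hxfirst h' h1 h2
      h3 h4 fun h => absurd h (h4.trans_lt hbt).ne

end

/-! ### Intervals and Hardy's lemma -/

theorem mem_ival {a b : ℝ≥0∞} {t : ℝ} :
    t ∈ ival a b ↔ a < ENNReal.ofReal t ∧ ENNReal.ofReal t < b := Iff.rfl

theorem measurableSet_ival (a b : ℝ≥0∞) : MeasurableSet (ival a b) :=
  ENNReal.measurable_ofReal measurableSet_Ioo

theorem ival_subset_ival {a b c d : ℝ≥0∞} (hac : c ≤ a) (hbd : b ≤ d) : ival a b ⊆ ival c d :=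
  fun _ ht => ⟨hac.trans_lt ht.1, ht.2.trans_le hbd⟩

theorem pos_of_mem_ival {a b : ℝ≥0∞} {t : ℝ} (ht : t ∈ ival a b) : 0 < t :=
  ENNReal.ofReal_pos.1 (zero_le.trans_lt ht.1)

theorem ival_eq_Ioo {a b : ℝ} (ha : 0 ≤ a) :
    ival (ENNReal.ofReal a) (ENNReal.ofReal b) = Set.Ioo a b := by
  ext t
  rw [mem_ival, Set.mem_Ioo]
  constructor
  · rintro ⟨h1, h2⟩
    exact ⟨(ENNReal.ofReal_lt_ofReal_iff_of_nonneg ha).1 h1,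
      (ENNReal.ofReal_lt_ofReal_iff_of_nonneg (ENNReal.ofReal_pos.1 (zero_le.trans_lt h1)).le).1 h2⟩
  · rintro ⟨h1, h2⟩
    exact ⟨(ENNReal.ofReal_lt_ofReal_iff_of_nonneg ha).2 h1,
      (ENNReal.ofReal_lt_ofReal_iff_of_nonneg (ha.trans h1.le)).2 h2⟩

theorem ival_top {a : ℝ} (ha : 0 ≤ a) : ival (ENNReal.ofReal a) ∞ = Set.Ioi a := by
  ext t
  rw [mem_ival, Set.mem_Ioi, ENNReal.ofReal_lt_ofReal_iff_of_nonneg ha]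
  exact and_iff_left ENNReal.ofReal_lt_top

theorem volume_ival_zero (t : ℝ≥0∞) : volume (ival 0 t) = t := by
  rcases eq_or_ne t ∞ with rfl | ht
  · have := ival_top (le_refl (0 : ℝ))
    rw [ENNReal.ofReal_zero] at this
    rw [this, Real.volume_Ioi]
  · have := ival_eq_Ioo (b := t.toReal) (le_refl (0 : ℝ))
    rw [ENNReal.ofReal_zero, ENNReal.ofReal_toReal ht] at this
    rw [this, Real.volume_Ioo, sub_zero, ENNReal.ofReal_toReal ht]

/-- Hardy's lemma, for a function `h` which is decreasing off a null set. -/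
theorem lintegral_mul_le_of_antitoneOn {τ : ℝ≥0∞} {p q : ℝ → ℝ≥0∞} {h : ℝ → ℝ} {N : Set ℝ}
    (hp : AEMeasurable p (volume.restrict (ival 0 τ)))
    (hq : AEMeasurable q (volume.restrict (ival 0 τ)))
    (hle : ∀ t ≤ τ, ∫⁻ s in ival 0 t, p s ≤ ∫⁻ s in ival 0 t, q s)
    (hN : volume N = 0) (hh0 : ∀ x, 0 ≤ h x)
    (hhm : AEMeasurable h (volume.restrict (ival 0 τ)))
    (hh : AntitoneOn h (ival 0 τ \ N)) :
    ∫⁻ s in ival 0 τ, p s * ENNReal.ofReal (h s) ≤ ∫⁻ s in ival 0 τ, q s * ENNReal.ofReal (h s) := by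
  set μ := volume.restrict (ival 0 τ) with hμ
  -- Layer-cake formula for the measure with density `r`: it reduces the claim to superlevel sets of
  -- `h`.
  have key : ∀ r : ℝ → ℝ≥0∞, AEMeasurable r μ → ∫⁻ s, r s * ENNReal.ofReal (h s) ∂μ =
      ∫⁻ s in Set.Ioi 0, (μ.withDensity r) {a | s < h a} := by
    intro r hr
    rw [← lintegral_eq_lintegral_meas_lt (μ.withDensity r) (Eventually.of_forall hh0)
      (hhm.mono_ac (withDensity_absolutelyContinuous _ _)),
      lintegral_withDensity_eq_lintegral_mul₀ hr hhm.ennreal_ofReal]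
    rfl
  -- Superlevel sets of a decreasing function are initial intervals, up to `N` and the right
  -- endpoint; on these the claim is the hypothesis `hle`.
  have hset : ∀ s : ℝ, ∃ t ≤ τ, ({a | s < h a} : Set ℝ) =ᵐ[μ] ival 0 t := by
    intro s
    set t := sSup (ENNReal.ofReal '' {x ∈ ival 0 τ \ N | s < h x}) with ht
    have htτ : t ≤ τ := sSup_le (by rintro _ ⟨x, hx, rfl⟩; exact hx.1.1.2.le)
    refine ⟨t, htτ, ?_⟩
    have h1 : ∀ᵐ x ∂μ, x ∉ N := ae_restrict_of_ae (measure_eq_zero_iff_ae_notMem.1 hN)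
    have h2 : ∀ᵐ x ∂μ, x ∉ ({t.toReal} : Set ℝ) :=
      ae_restrict_of_ae (measure_eq_zero_iff_ae_notMem.1 (by simp))
    filter_upwards [h1, h2, ae_restrict_mem (measurableSet_ival 0 τ)] with x hx1 hx2 hx3
    refine propext ⟨fun hx => ⟨hx3.1, lt_of_le_of_ne
      (le_sSup ⟨x, ⟨⟨hx3, hx1⟩, hx⟩, rfl⟩) fun heq => hx2 ?_⟩, fun hx => ?_⟩
    · rw [← heq, ENNReal.toReal_ofReal (pos_of_mem_ival hx3).le]
      exact Set.mem_singleton x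
    · obtain ⟨_, ⟨y, hy, rfl⟩, hxy⟩ := lt_sSup_iff.1 hx.2
      exact lt_of_lt_of_le hy.2 (hh ⟨hx3, hx1⟩ hy.1 (ENNReal.ofReal_lt_ofReal_iff'.1 hxy).1.le)
  rw [key p hp, key q hq]
  refine lintegral_mono fun s => ?_
  obtain ⟨t, ht, hst⟩ := hset s
  have hI : ival 0 t ∩ ival 0 τ = ival 0 t :=
    Set.inter_eq_left.2 (ival_subset_ival le_rfl ht)
  rw [measure_congr ((withDensity_absolutelyContinuous μ p).ae_le hst),
    measure_congr ((withDensity_absolutelyContinuous μ q).ae_le hst),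
    withDensity_apply _ (measurableSet_ival _ _), withDensity_apply _ (measurableSet_ival _ _), hμ,
    Measure.restrict_restrict (measurableSet_ival _ _), hI]
  exact hle t ht

/-! ### The decreasing rearrangement -/

theorem rearr_antitone (α : ℝ≥0∞) (f : ℝ → ℝ) : Antitone (rearr α f) := fun _ _ h =>
  sInf_le_sInf fun _ hl => ⟨hl.1, hl.2.trans (ENNReal.ofReal_le_ofReal h)⟩

theorem distribution_antitone (α : ℝ≥0∞) (f : ℝ → ℝ) : Antitone (distribution α f) := fun _ _ h =>
  measure_mono fun _ ht => ⟨ht.1, h.trans_lt ht.2⟩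

/-- For `l' > h t`, the set where `h > l'` lies in `(0, t)`. Equality can fail at a jump, where `h`
may exceed its right limit. -/
theorem rearr_le_of_antitoneOn {α : ℝ≥0∞} {h : ℝ → ℝ} (hh : AntitoneOn h (ival 0 α))
    (h0 : ∀ t ∈ ival 0 α, 0 ≤ h t) {t : ℝ} (ht : t ∈ ival 0 α) :
    rearr α h t ≤ ENNReal.ofReal (h t) := by
  refine le_of_forall_gt fun l hl => ?_
  obtain ⟨l', hl1, hl2⟩ := exists_between hl
  refine lt_of_le_of_lt (sInf_le ⟨zero_le.trans_lt hl1, ?_⟩) hl2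
  rw [← volume_ival_zero (ENNReal.ofReal t)]
  refine measure_mono fun s hs => ⟨hs.1.1, ?_⟩
  by_contra! hts
  have hts' : t ≤ s := (ENNReal.ofReal_le_ofReal_iff (pos_of_mem_ival hs.1).le).1 hts
  have h1 := hh ht hs.1 hts'
  have h2 := hs.2
  rw [abs_of_nonneg (h0 s hs.1)] at h2
  exact absurd (ENNReal.ofReal_le_ofReal h1) (hl1.trans h2).not_ge

/-- At height `s` the set `{|g| > s}` in `(0, t)` has measure at most `min t d`, with `d` the
distribution function at `s`, while the rearrangement is at least `s` on all of `(0, min t d)`. The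
layer-cake formula integrates this comparison. -/
theorem lintegral_le_lintegral_rearr {α : ℝ≥0∞} {g : ℝ → ℝ} (hg : MemL0 α g) {t : ℝ≥0∞}
    (ht : t ≤ α) (hfin : ∀ x ∈ ival 0 t, rearr α g x ≠ ∞) :
    ∫⁻ s in ival 0 t, ENNReal.ofReal |g s| ≤ ∫⁻ s in ival 0 t, rearr α g s := by
  set μ := volume.restrict (ival 0 t) with hμ
  have hgm : AEMeasurable (fun s => |g s|) μ :=
    (AEMeasurable.mono_measure hg (Measure.restrict_mono (ival_subset_ival le_rfl ht) le_rfl)).abs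
  have hrm : Measurable (rearr α g) := (rearr_antitone α g).measurable
  have e : ∫⁻ s, rearr α g s ∂μ = ∫⁻ s, ENNReal.ofReal (rearr α g s).toReal ∂μ :=
    setLIntegral_congr_fun (measurableSet_ival _ _) fun x hx => (ENNReal.ofReal_toReal (hfin x hx)).symm
  rw [e, lintegral_eq_lintegral_meas_lt μ (Eventually.of_forall fun x => abs_nonneg _) hgm,
    lintegral_eq_lintegral_meas_le μ (Eventually.of_forall fun x => ENNReal.toReal_nonneg)
      hrm.ennreal_toReal.aemeasurable]
  refine setLIntegral_mono' measurableSet_Ioi fun s hs => ?_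
  have hs' : (0 : ℝ) < s := hs
  set d := distribution α g (ENNReal.ofReal s) with hd
  have h1 : μ {a | s < |g a|} ≤ min t d := by
    refine le_min ?_ ?_
    · refine (measure_mono (Set.subset_univ _)).trans ?_
      rw [hμ, Measure.restrict_apply_univ, volume_ival_zero]
    · rw [hμ, Measure.restrict_apply₀' (measurableSet_ival _ _).nullMeasurableSet]
      refine measure_mono fun x hx => ⟨ival_subset_ival le_rfl ht hx.2, ?_⟩
      exact (ENNReal.ofReal_lt_ofReal_iff (hs'.trans hx.1)).2 hx.1
  refine h1.trans ?_
  rw [← volume_ival_zero (min t d), hμ, Measure.restrict_apply₀' (measurableSet_ival _ _).nullMeasurableSet]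
  refine measure_mono fun x hx => ?_
  have hx' : x ∈ ival 0 t := ival_subset_ival le_rfl (min_le_left _ _) hx
  refine ⟨?_, hx'⟩
  show s ≤ _
  rw [← ENNReal.ofReal_le_iff_le_toReal (hfin x hx')]
  refine le_sInf fun l hl => ?_
  by_contra! hlt
  have := distribution_antitone α g hlt.le
  exact absurd (this.trans hl.2) (hx.2.trans_le (min_le_right _ _)).not_ge

theorem rearr_le_mul_rearr_div {α : ℝ≥0∞} (f : ℝ → ℝ) {c : ℝ} (hc : 0 < c) (t : ℝ) :
    rearr α f t ≤ ENNReal.ofReal c * rearr α (fun t => f t / c) t := by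
  have hc0 : ENNReal.ofReal c ≠ 0 := (ENNReal.ofReal_pos.2 hc).ne'
  rw [mul_comm, ← ENNReal.div_le_iff_le_mul (Or.inl hc0) (Or.inl ENNReal.ofReal_ne_top)]
  refine le_sInf fun l hl => ?_
  rw [ENNReal.div_le_iff_le_mul (Or.inl hc0) (Or.inl ENNReal.ofReal_ne_top)]
  rw [rearr]
  have hd : distribution α f (l * ENNReal.ofReal c) ≤ distribution α (fun t => f t / c) l := by
    refine measure_mono fun x hx => ⟨hx.1, ?_⟩
    rw [abs_div, abs_of_pos hc, ENNReal.ofReal_div_of_pos hc,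
      ENNReal.lt_div_iff_mul_lt (Or.inl hc0) (Or.inl ENNReal.ofReal_ne_top)]
    exact hx.2
  exact sInf_le ⟨ENNReal.mul_pos hl.1.ne' hc0, hd.trans hl.2⟩

/-! ### Subgradients and Young's inequality -/

/-- `D` is a nonnegative selection of subgradients of `φ` on `[0, ∞)`. -/
structure IsSubgradient (φ D : ℝ → ℝ) : Prop where
  nonneg : ∀ v, 0 ≤ v → 0 ≤ D v
  le : ∀ v, 0 ≤ v → ∀ x, 0 ≤ x → φ v + D v * (x - v) ≤ φ x

theorem IsNFunction.nonneg {φ : ℝ → ℝ} (hφ : IsNFunction φ) {x : ℝ} (hx : 0 ≤ x) : 0 ≤ φ x :=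
  hφ.map_zero ▸ hφ.strictMonoOn.monotoneOn (Set.mem_Ici.2 le_rfl) (Set.mem_Ici.2 hx) hx

theorem IsNFunction.pos {φ : ℝ → ℝ} (hφ : IsNFunction φ) {x : ℝ} (hx : 0 < x) : 0 < φ x :=
  hφ.map_zero ▸ hφ.strictMonoOn (Set.mem_Ici.2 le_rfl) (Set.mem_Ici.2 hx.le) hx

/-- The right derivative works at `v > 0`, and testing its inequality at `0` gives its sign. At `v =
0` the value `0` is a subgradient because `φ ≥ 0 = φ 0`. -/
theorem IsNFunction.exists_isSubgradient {φ : ℝ → ℝ} (hφ : IsNFunction φ) :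
    ∃ D, IsSubgradient φ D := by
  have hpos : ∀ v, 0 < v → ∀ x, 0 ≤ x →
      φ v + derivWithin φ (Set.Ioi v) v * (x - v) ≤ φ x := by
    intro v hv x hx
    have hvi : v ∈ interior (Set.Ici (0 : ℝ)) := by rw [interior_Ici]; exact hv
    rcases lt_trichotomy x v with h | h | h
    · have h1 := (hφ.convexOn.slope_le_leftDeriv_of_mem_interior hx hvi h).trans
        (hφ.convexOn.leftDeriv_le_rightDeriv_of_mem_interior hvi)
      rw [slope_def_field, div_le_iff₀ (by linarith)] at h1
      linarith
    · subst h; simp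
    · have h1 := hφ.convexOn.rightDeriv_le_slope_of_mem_interior hvi hx h
      rw [slope_def_field, le_div_iff₀ (by linarith)] at h1
      linarith
  refine ⟨fun v => if v = 0 then 0 else derivWithin φ (Set.Ioi v) v, fun v hv => ?_,
    fun v hv x hx => ?_⟩
  · split_ifs with h
    · exact le_rfl
    · have hv' := lt_of_le_of_ne hv (Ne.symm h)
      have h1 := hpos v hv' 0 le_rfl
      have h2 := hφ.pos hv'
      rw [hφ.map_zero] at h1
      by_contra! hneg
      nlinarith
  · split_ifs with h
    · rw [h, hφ.map_zero]; simpa using hφ.nonneg hx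
    · exact hpos v (lt_of_le_of_ne hv (Ne.symm h)) x hx

/-- The quantity `v * D v - φ v` is the convex conjugate of `φ` at `D v`, the equality case of
Young's inequality. -/
theorem IsSubgradient.conj_nonneg {φ D : ℝ → ℝ} (hφ : IsNFunction φ) (hD : IsSubgradient φ D)
    {v : ℝ} (hv : 0 ≤ v) : 0 ≤ v * D v - φ v := by
  have := hD.le v hv 0 le_rfl
  rw [hφ.map_zero] at this
  linarith

theorem IsSubgradient.monotone {φ D : ℝ → ℝ} (hD : IsSubgradient φ D) {v v' : ℝ} (hv : 0 ≤ v)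
    (h : v ≤ v') : D v ≤ D v' := by
  rcases h.eq_or_lt with rfl | h
  · exact le_rfl
  have h1 := hD.le v hv v' (hv.trans h.le)
  have h2 := hD.le v' (hv.trans h.le) v hv
  by_contra! hlt
  nlinarith

theorem IsSubgradient.conj_monotone {φ D : ℝ → ℝ} (hD : IsSubgradient φ D) {v v' : ℝ}
    (hv : 0 ≤ v) (h : v ≤ v') : v * D v - φ v ≤ v' * D v' - φ v' := by
  have h1 := hD.le v' (hv.trans h) v hv
  have h2 := hD.monotone hv h
  nlinarith

/-- Young's inequality in perspective form: the subgradient inequality at `v`, tested at `x / y` and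
multiplied by `y`. The convention for `y = 0` keeps it true there. -/
theorem IsSubgradient.mul_le_persp {φ D : ℝ → ℝ} (hφ : IsNFunction φ) (hD : IsSubgradient φ D)
    {v : ℝ} (hv : 0 ≤ v) (x : ℝ≥0∞) {y : ℝ≥0∞} (hy : y ≠ ∞) :
    ENNReal.ofReal (D v) * x ≤ persp φ x y + ENNReal.ofReal (v * D v - φ v) * y := by
  rw [persp]
  split_ifs with h1 h2 h3
  · simp [h2]
  · simp
  · rw [ENNReal.top_mul h1, top_add]
    exact le_top
  · set u := (x / y).toReal with hu
    have hx : x = ENNReal.ofReal u * y := by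
      rw [hu, ENNReal.ofReal_toReal h3, ENNReal.div_mul_cancel h1 hy]
    have hu0 : 0 ≤ u := ENNReal.toReal_nonneg
    rw [hx, ← mul_assoc, ← add_mul, ← ENNReal.ofReal_mul (hD.nonneg v hv),
      ← ENNReal.ofReal_add (hφ.nonneg hu0) (hD.conj_nonneg hφ hv)]
    gcongr
    have := hD.le v hv u hu0
    linarith

/-! ### Integrals over intervals and primitives -/

theorem isOpen_ival (a b : ℝ≥0∞) : IsOpen (ival a b) :=
  isOpen_Ioo.preimage ENNReal.continuous_ofReal

theorem lintegral_ival_add {a b c : ℝ≥0∞} (hab : a ≤ b) (hbc : b ≤ c) (p : ℝ → ℝ≥0∞) :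
    ∫⁻ s in ival a c, p s = (∫⁻ s in ival a b, p s) + ∫⁻ s in ival b c, p s := by
  rw [← lintegral_union (measurableSet_ival b c)]
  · refine setLIntegral_congr ?_
    have h : ∀ᵐ x : ℝ, x ∉ ({b.toReal} : Set ℝ) := measure_eq_zero_iff_ae_notMem.1 (by simp)
    filter_upwards [h] with x hx
    refine propext ⟨fun hx' => ?_, fun hx' => ?_⟩
    · rcases lt_trichotomy (ENNReal.ofReal x) b with h | h | h
      · exact Or.inl ⟨hx'.1, h⟩
      · refine absurd ?_ hx
        rw [← h, ENNReal.toReal_ofReal (pos_of_mem_ival hx').le]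
        exact Set.mem_singleton x
      · exact Or.inr ⟨h, hx'.2⟩
    · rcases hx' with h | h
      · exact ⟨h.1, h.2.trans_le hbc⟩
      · exact ⟨hab.trans_lt h.1, h.2⟩
  · rw [Set.disjoint_left]
    exact fun x hx hx' => (hx.2.trans hx'.1).false

theorem volume_ival_pos {a b : ℝ≥0∞} (hab : a < b) : 0 < volume (ival a b) := by
  refine (isOpen_ival a b).measure_pos volume ?_
  obtain ⟨c, h1, h2⟩ := exists_between hab
  refine ⟨c.toReal, ?_⟩
  rw [mem_ival, ENNReal.ofReal_toReal (h2.trans_le le_top).ne]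
  exact ⟨h1, h2⟩

theorem lintegral_ival_le_of_forall_lt {τ C : ℝ≥0∞} {p : ℝ → ℝ≥0∞}
    (h : ∀ t < τ, ∫⁻ s in ival 0 t, p s ≤ C) : ∫⁻ s in ival 0 τ, p s ≤ C := by
  rcases eq_or_ne τ 0 with rfl | hτ
  · have : ival 0 0 = ∅ := Set.eq_empty_of_forall_notMem fun x hx => (hx.1.trans hx.2).false
    simp [this]
  obtain ⟨u, hu, hu', hlim⟩ := exists_seq_strictMono_tendsto' (pos_iff_ne_zero.2 hτ)
  have hU : ival 0 τ = ⋃ n, ival 0 (u n) := by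
    ext x
    rw [Set.mem_iUnion]
    constructor
    · intro hx
      obtain ⟨n, hn⟩ := (hlim.eventually (lt_mem_nhds hx.2)).exists
      exact ⟨n, hx.1, hn⟩
    · rintro ⟨n, hn⟩
      exact ⟨hn.1, hn.2.trans (hu' n).2⟩
  rw [hU, setLIntegral_iUnion_of_directed]
  · exact iSup_le fun n => h _ (hu' n).2
  · exact directed_of_isDirected_le fun i j hij => ival_subset_ival le_rfl (hu.monotone hij)

theorem integ_eq_top_of_le {h : ℝ → ℝ} {a b : ℝ≥0∞} (hab : a ≤ b) (ha : integ h 0 a ≠ ∞)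
    (hb : integ h 0 b = ∞) : integ h a b = ∞ := by
  have := lintegral_ival_add zero_le hab (fun s => ENNReal.ofReal (h s))
  by_contra hcon
  exact (ENNReal.add_lt_top.2 ⟨lt_top_iff_ne_top.2 ha, lt_top_iff_ne_top.2 hcon⟩).ne
    (this.symm.trans hb)

/-- The primitive `x ↦ ∫₀ˣ h`. -/
noncomputable def prim (h : ℝ → ℝ) (x : ℝ≥0∞) : ℝ := (integ h 0 x).toReal

/-- `h` is measurable on `I`, and it is integrable near `0`. -/
structure HasPrim (α : ℝ≥0∞) (h : ℝ → ℝ) : Prop where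
  memL0 : MemL0 α h
  lt_top : ∀ x ≤ α, x < ∞ → integ h 0 x < ∞

section

variable {α : ℝ≥0∞} {h : ℝ → ℝ}

theorem prim_zero : prim h 0 = 0 := by
  have : ival 0 0 = ∅ := Set.eq_empty_of_forall_notMem fun x hx => (hx.1.trans hx.2).false
  simp [prim, integ, this]

theorem prim_nonneg (x : ℝ≥0∞) : 0 ≤ prim h x := ENNReal.toReal_nonneg

theorem HasPrim.ofReal_prim (hh : HasPrim α h) {x : ℝ≥0∞} (hx : x ≤ α) (hx' : x < ∞) :
    ENNReal.ofReal (prim h x) = integ h 0 x := ENNReal.ofReal_toReal (hh.lt_top x hx hx').ne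

theorem HasPrim.monotoneOn (hh : HasPrim α h) : MonotoneOn (prim h) {x | x ≤ α ∧ x < ∞} :=
  fun _ _ b hb hab => ENNReal.toReal_mono (hh.lt_top b hb.1 hb.2).ne
    (lintegral_mono_set (ival_subset_ival le_rfl hab))

theorem HasPrim.integ_eq (hh : HasPrim α h) {a b : ℝ≥0∞} (hab : a ≤ b) (hb : b ≤ α)
    (hb' : b < ∞) : integ h a b = ENNReal.ofReal (prim h b - prim h a) := by
  have e := lintegral_ival_add zero_le hab (fun s => ENNReal.ofReal (h s))
  have ha := hh.lt_top a (hab.trans hb) (hab.trans_lt hb')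
  rw [ENNReal.ofReal_sub _ (prim_nonneg a), hh.ofReal_prim hb hb',
    hh.ofReal_prim (hab.trans hb) (hab.trans_lt hb')]
  refine ENNReal.eq_sub_of_add_eq ha.ne ?_
  rw [add_comm]
  exact e.symm

/-- Extending `h⁺` by zero outside `I` gives a function integrable on every half line `(-∞, T]`, to
which the continuity of interval integrals applies. -/
theorem HasPrim.continuousOn (hh : HasPrim α h) :
    ContinuousOn (prim h) {x | x ≤ α ∧ x < ∞} := by
  set g : ℝ → ℝ := fun t => (ENNReal.ofReal (h t)).toReal with hg
  set k : ℝ → ℝ := (ival 0 α).indicator g with hk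
  have hkT : ∀ T : ℝ, IntegrableOn k (Set.Iic T) := by
    intro T
    rw [IntegrableOn, hk, integrable_indicator_iff (measurableSet_ival _ _), IntegrableOn,
      Measure.restrict_restrict (measurableSet_ival _ _)]
    refine integrable_toReal_of_lintegral_ne_top (AEMeasurable.mono_measure hh.memL0
      (Measure.restrict_mono Set.inter_subset_left le_rfl)).ennreal_ofReal ?_
    have hm := hh.lt_top (min α (ENNReal.ofReal (T + 1))) (min_le_left _ _)
      ((min_le_right _ _).trans_lt ENNReal.ofReal_lt_top)
    refine (lt_of_le_of_lt (lintegral_mono_set fun x hx => ?_) hm).ne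
    refine ⟨hx.1.1, lt_min hx.1.2 ?_⟩
    have h1 := pos_of_mem_ival hx.1
    have h2 : x ≤ T := hx.2
    exact (ENNReal.ofReal_lt_ofReal_iff_of_nonneg h1.le).2 (by linarith)
  have hc : Continuous fun b => ∫ x in (0 : ℝ)..b, k x := by
    refine intervalIntegral.continuous_primitive (fun a b => ?_) 0
    rw [intervalIntegrable_iff]
    exact (hkT (max a b)).mono_set fun x hx => hx.2
  have hc' := hc.comp_continuousOn (ENNReal.continuousOn_toReal.mono
    (fun x (hx : x ∈ {x | x ≤ α ∧ x < ∞}) => hx.2.ne))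
  refine hc'.congr fun x hx => ?_
  have hx0 : (0 : ℝ) ≤ x.toReal := ENNReal.toReal_nonneg
  have hI : ival 0 x = Set.Ioo 0 x.toReal := by
    have := ival_eq_Ioo (b := x.toReal) (le_refl (0 : ℝ))
    rwa [ENNReal.ofReal_zero, ENNReal.ofReal_toReal hx.2.ne] at this
  show _ = ∫ x in (0 : ℝ)..x.toReal, k x
  rw [intervalIntegral.integral_of_le hx0, setIntegral_congr_set Ioo_ae_eq_Ioc.symm, ← hI]
  have : ∫ t in ival 0 x, k t = ∫ t in ival 0 x, g t :=
    setIntegral_congr_fun (measurableSet_ival _ _) fun t ht => by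
      rw [hk, Set.indicator_of_mem (ival_subset_ival le_rfl hx.1 ht)]
  rw [this, hg, integral_toReal, prim, integ]
  · exact (AEMeasurable.mono_measure hh.memL0
      (Measure.restrict_mono (ival_subset_ival le_rfl hx.1) le_rfl)).ennreal_ofReal
  · exact Eventually.of_forall fun _ => ENNReal.ofReal_lt_top

end

theorem IsWeight.memL0 {α : ℝ≥0∞} {w : ℝ → ℝ} (hw : IsWeight α w) : MemL0 α w :=
  aemeasurable_restrict_of_antitoneOn (measurableSet_ival _ _) hw.antitoneOn

/-- Finiteness is only assumed for `x < α`. At a finite endpoint `x = α` the function is bounded by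
`h c` on `(c, x)`. -/
theorem integ_lt_top_of_antitoneOn {α : ℝ≥0∞} {h : ℝ → ℝ} (hh : AntitoneOn h (ival 0 α))
    (hfin : ∀ x < α, integ h 0 x < ∞) {x : ℝ≥0∞} (hx : x ≤ α) (hx' : x < ∞) :
    integ h 0 x < ∞ := by
  rcases hx.lt_or_eq with hlt | rfl
  · exact hfin x hlt
  rcases eq_or_ne x 0 with rfl | h0
  · have : ival 0 0 = ∅ := Set.eq_empty_of_forall_notMem fun x hx => (hx.1.trans hx.2).false
    simp [integ, this]
  obtain ⟨c, hc0, hcx⟩ := exists_between (pos_iff_ne_zero.2 h0)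
  have hcm : c.toReal ∈ ival 0 x := by
    rw [mem_ival, ENNReal.ofReal_toReal (hcx.trans hx').ne]
    exact ⟨hc0, hcx⟩
  have e := lintegral_ival_add zero_le hcx.le (fun s => ENNReal.ofReal (h s))
  rw [integ, e]
  refine ENNReal.add_lt_top.2 ⟨hfin c hcx, ?_⟩
  have hle : ∀ s ∈ ival c x, ENNReal.ofReal (h s) ≤ ENNReal.ofReal (h c.toReal) := by
    intro s hs
    have hs' : s ∈ ival 0 x := ival_subset_ival zero_le le_rfl hs
    refine ENNReal.ofReal_le_ofReal (hh hcm hs' ?_)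
    exact ENNReal.toReal_le_of_le_ofReal (pos_of_mem_ival hs').le hs.1.le
  refine (setLIntegral_mono' (measurableSet_ival _ _) hle).trans_lt ?_
  rw [setLIntegral_const]
  refine ENNReal.mul_lt_top ENNReal.ofReal_lt_top ?_
  refine (measure_mono (ival_subset_ival zero_le le_rfl)).trans_lt ?_
  rwa [volume_ival_zero]

theorem IsWeight.hasPrim {α : ℝ≥0∞} {w : ℝ → ℝ} (hw : IsWeight α w) : HasPrim α w :=
  ⟨hw.memL0, fun _ hx hx' => integ_lt_top_of_antitoneOn hw.antitoneOn hw.integ_lt_top hx hx'⟩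

theorem IsWeight.integ_pos {α : ℝ≥0∞} {w : ℝ → ℝ} (hw : IsWeight α w) {a b : ℝ≥0∞}
    (hab : a < b) (hb : b ≤ α) : 0 < integ w a b := by
  rw [pos_iff_ne_zero, integ, Ne, lintegral_eq_zero_iff' (AEMeasurable.mono_measure hw.memL0
    (Measure.restrict_mono (ival_subset_ival zero_le hb) le_rfl)).ennreal_ofReal]
  intro h
  have h' : ∀ᵐ x ∂volume.restrict (ival a b), False := by
    filter_upwards [h, ae_restrict_mem (measurableSet_ival a b)] with x hx hx'
    exact (ENNReal.ofReal_pos.2 (hw.pos x (ival_subset_ival zero_le hb hx'))).ne' hx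
  rw [ae_iff] at h'
  simp only [not_false_eq_true, Set.ofPred_true, Measure.restrict_apply_univ] at h'
  exact (volume_ival_pos hab).ne' h'

/-! ### Admissible pairs and ratios at infinity -/

/-- A weight `w` and a decreasing function `f ≥ 0` whose primitive is dominated by that
of `w`. -/
structure IsAdmissible (α : ℝ≥0∞) (w f : ℝ → ℝ) : Prop where
  weight : IsWeight α w
  integ_top : α = ∞ → integ w 0 ∞ = ∞
  antitoneOn : AntitoneOn f (ival 0 α)
  nonneg : ∀ t ∈ ival 0 α, 0 ≤ f t
  integ_lt_top : ∀ t < α, integ f 0 t < ∞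
  bound : ∃ A B : ℝ, ∀ t < α, prim f t ≤ A + B * prim w t

section

variable {α : ℝ≥0∞} {w f : ℝ → ℝ}

theorem IsAdmissible.hasPrim (hA : IsAdmissible α w f) : HasPrim α f :=
  ⟨aemeasurable_restrict_of_antitoneOn (measurableSet_ival _ _) hA.antitoneOn,
    fun _ hx hx' => integ_lt_top_of_antitoneOn hA.antitoneOn hA.integ_lt_top hx hx'⟩

theorem IsAdmissible.strictMonoOn (hA : IsAdmissible α w f) :
    StrictMonoOn (prim w) {x | x ≤ α ∧ x < ∞} := by
  intro a _ b hb hab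
  have h1 := hA.weight.integ_pos hab hb.1
  rw [hA.weight.hasPrim.integ_eq hab.le hb.1 hb.2] at h1
  exact sub_pos.1 (ENNReal.ofReal_pos.1 h1)

theorem IsAdmissible.unbounded (hA : IsAdmissible α w f) (hα : α = ∞) (M : ℝ) :
    ∃ x < ∞, ∀ y, x ≤ y → y < ∞ → M ≤ prim w y := by
  by_contra! hcon
  have : integ w 0 ∞ ≤ ENNReal.ofReal M := by
    refine lintegral_ival_le_of_forall_lt fun t ht => ?_
    obtain ⟨y, hty, hy, hM⟩ := hcon t ht
    refine le_trans ?_ (ENNReal.ofReal_le_ofReal hM.le)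
    rw [hA.weight.hasPrim.ofReal_prim (hα ▸ le_top) hy]
    exact lintegral_mono_set (ival_subset_ival le_rfl hty)
  rw [hA.integ_top hα] at this
  exact this.not_gt ENNReal.ofReal_lt_top

theorem IsAdmissible.ratio_of_lt_top (hA : IsAdmissible α w f) {a b : ℝ≥0∞} (hab : a < b)
    (hb : b ≤ α) (hb' : b < ∞) :
    ratio w f a b = ENNReal.ofReal ((prim f b - prim f a) / (prim w b - prim w a)) := by
  have hW : 0 < prim w b - prim w a := sub_pos.2
    (hA.strictMonoOn ⟨hab.le.trans hb, hab.trans hb'⟩ ⟨hb, hb'⟩ hab)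
  rw [ratio, if_neg hb'.ne, hA.hasPrim.integ_eq hab.le hb hb',
    hA.weight.hasPrim.integ_eq hab.le hb hb', ENNReal.ofReal_div_of_pos hW]

theorem IsAdmissible.ratio_top (hA : IsAdmissible α w f) (hα : α = ∞) {a : ℝ≥0∞} (ha : a < ∞) :
    ratio w f a ∞ = limsup (fun t : ℝ => ENNReal.ofReal ((prim f (ENNReal.ofReal t) - prim f a) /
      (prim w (ENNReal.ofReal t) - prim w a))) atTop := by
  rw [ratio, if_pos rfl]
  refine limsup_congr ?_
  filter_upwards [eventually_gt_atTop a.toReal] with t ht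
  have hat : a < ENNReal.ofReal t := (ENNReal.lt_ofReal_iff_toReal_lt ha.ne).2 ht
  have := hA.ratio_of_lt_top hat (hα ▸ le_top) ENNReal.ofReal_lt_top
  rwa [ratio, if_neg ENNReal.ofReal_ne_top] at this

theorem IsAdmissible.eventually_le (hA : IsAdmissible α w f) (hα : α = ∞) (C : ℝ) :
    ∀ᶠ t : ℝ in atTop, C ≤ prim w (ENNReal.ofReal t) := by
  obtain ⟨x, hx, hx'⟩ := hA.unbounded hα C
  filter_upwards [eventually_ge_atTop x.toReal] with t ht
  exact hx' _ ((ENNReal.le_ofReal_iff_toReal_le hx.ne (ENNReal.toReal_nonneg.trans ht)).2 ht)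
    ENNReal.ofReal_lt_top

theorem IsAdmissible.ratio_zero_top_ne_top (hA : IsAdmissible α w f) (hα : α = ∞) :
    ratio w f 0 ∞ ≠ ∞ := by
  obtain ⟨A, B, hAB⟩ := hA.bound
  rw [hA.ratio_top hα ENNReal.zero_lt_top]
  -- Once `W ≥ 1`, the bound `F ≤ A + B W` gives `F / W ≤ |A| + B`.
  refine (lt_of_le_of_lt (limsup_le_of_le (by isBoundedDefault) (a := ENNReal.ofReal (|A| + B))
    ?_) ENNReal.ofReal_lt_top).ne
  filter_upwards [hA.eventually_le hα 1] with t ht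
  refine ENNReal.ofReal_le_ofReal ?_
  rw [prim_zero, prim_zero, sub_zero, sub_zero, div_le_iff₀ (by linarith)]
  have := hAB (ENNReal.ofReal t) (hα ▸ ENNReal.ofReal_lt_top)
  nlinarith [le_abs_self A, abs_nonneg A]

theorem IsAdmissible.primitivePair (hA : IsAdmissible α w f) :
    PrimitivePair α (prim w) (prim f) (ratio w f 0 ∞).toReal where
  strictMonoOn := hA.strictMonoOn
  monotoneOn := hA.hasPrim.monotoneOn
  continuousOn_left := hA.weight.hasPrim.continuousOn
  continuousOn_right := hA.hasPrim.continuousOn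
  unbounded := hA.unbounded
  upper := by
    intro hα m hm
    have hm' : ratio w f 0 ∞ < ENNReal.ofReal m :=
      (ENNReal.lt_ofReal_iff_toReal_lt (hA.ratio_zero_top_ne_top hα)).2 hm
    rw [hA.ratio_top hα ENNReal.zero_lt_top] at hm'
    have hm0 : 0 < m := ENNReal.toReal_nonneg.trans_lt hm
    obtain ⟨T, hT⟩ := eventually_atTop.1
      ((eventually_lt_of_limsup_lt hm').and (hA.eventually_le hα 1))
    refine ⟨ENNReal.ofReal T, ENNReal.ofReal_lt_top, fun y hy hy' => ?_⟩
    have h1 := hT y.toReal ((ENNReal.ofReal_le_iff_le_toReal hy'.ne).1 hy)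
    rw [ENNReal.ofReal_toReal hy'.ne, prim_zero, prim_zero, sub_zero, sub_zero,
      ENNReal.ofReal_lt_ofReal_iff hm0, div_lt_iff₀ (by linarith)] at h1
    exact h1.1.le
  lower := by
    intro hα m hm x hx
    rcases lt_or_ge m 0 with hm0 | hm0
    · obtain ⟨z, hz, hz'⟩ := hA.unbounded hα 1
      refine ⟨max x z, le_max_left _ _, max_lt hx hz, ?_⟩
      have h1 := hz' (max x z) (le_max_right _ _) (max_lt hx hz)
      have h2 := prim_nonneg (h := f) (max x z)
      nlinarith
    · have hm' : ENNReal.ofReal m < ratio w f 0 ∞ := by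
        rwa [ENNReal.ofReal_lt_iff_lt_toReal hm0 (hA.ratio_zero_top_ne_top hα)]
      rw [hA.ratio_top hα ENNReal.zero_lt_top] at hm'
      obtain ⟨t, ht1, ht2, ht3⟩ := ((frequently_lt_of_lt_limsup (by isBoundedDefault)
        hm').and_eventually ((hA.eventually_le hα 1).and (eventually_ge_atTop x.toReal))).exists
      refine ⟨ENNReal.ofReal t, (ENNReal.le_ofReal_iff_toReal_le hx.ne
        (ENNReal.toReal_nonneg.trans ht3)).2 ht3, ENNReal.ofReal_lt_top, ?_⟩
      rw [prim_zero, prim_zero, sub_zero, sub_zero, ENNReal.ofReal_lt_ofReal_iff_of_nonneg hm0,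
        lt_div_iff₀ (by linarith)] at ht1
      exact ht1

/-- Since `W → ∞`, subtracting the constants `F a` and `W a` does not change the upper limit of `F /
W`. Hence all unbounded chords share the slope `ρ`. -/
theorem IsAdmissible.ratio_top_eq (hA : IsAdmissible α w f) (hα : α = ∞) {a : ℝ≥0∞}
    (ha : a < ∞) : ratio w f a ∞ = ENNReal.ofReal (ratio w f 0 ∞).toReal := by
  have hP := hA.primitivePair
  set ρ := (ratio w f 0 ∞).toReal with hρ
  have hρ0 : 0 ≤ ρ := ENNReal.toReal_nonneg
  rw [hA.ratio_top hα ha]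
  have hfa := prim_nonneg (h := f) a
  have hwa := prim_nonneg (h := w) a
  refine le_antisymm ?_ ?_
  · refine ENNReal.le_of_forall_pos_le_add fun ε hε _ => ?_
    rw [← ENNReal.ofReal_coe_nnreal, ← ENNReal.ofReal_add hρ0 ε.coe_nonneg]
    have hε' : (0 : ℝ) < ε := hε
    obtain ⟨x, hx, hx'⟩ := hP.upper hα (ρ + ε / 2) (by linarith)
    refine limsup_le_of_le (by isBoundedDefault) ?_
    -- The threshold makes the spare `(ε / 2) W t` absorb `(ρ + ε) W a`, and the final `+ 1` keeps
    -- the denominator positive.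
    filter_upwards [hA.eventually_le hα (2 * (ρ + ε) * prim w a / ε + prim w a + 1),
      eventually_ge_atTop x.toReal] with t ht1 ht2
    have hxt := hx' (ENNReal.ofReal t) ((ENNReal.le_ofReal_iff_toReal_le hx.ne
        (ENNReal.toReal_nonneg.trans ht2)).2 ht2) ENNReal.ofReal_lt_top
    have h3 : 0 ≤ 2 * (ρ + ε) * prim w a / ε := by positivity
    refine ENNReal.ofReal_le_ofReal ?_
    rw [div_le_iff₀ (by linarith)]
    have h4 : 2 * (ρ + ε) * prim w a / ε ≤ prim w (ENNReal.ofReal t) := by linarith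
    rw [div_le_iff₀ hε'] at h4
    nlinarith
  · refine ENNReal.le_of_forall_pos_le_add fun ε hε _ => ?_
    have hε' : (0 : ℝ) < ε := hε
    have e : ENNReal.ofReal ρ ≤ ENNReal.ofReal (ρ - ε) + ε := by
      rw [← ENNReal.ofReal_coe_nnreal]
      refine le_trans (ENNReal.ofReal_le_ofReal ?_) ENNReal.ofReal_add_le
      linarith
    refine e.trans (add_le_add_left ?_ _)
    rcases le_or_gt (ρ - ε) 0 with h0 | h0
    · rw [ENNReal.ofReal_of_nonpos h0]; exact zero_le
    refine le_limsup_of_frequently_le' (frequently_atTop.2 fun T => ?_)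
    obtain ⟨T', hT'⟩ := eventually_atTop.1
      (hA.eventually_le hα (2 * prim f a / ε + prim w a + 1))
    obtain ⟨y, hy1, hy2, hy3⟩ := hP.lower hα (ρ - ε / 2) (by linarith)
      (ENNReal.ofReal (max T T')) ENNReal.ofReal_lt_top
    have hy1' := (ENNReal.ofReal_le_iff_le_toReal hy2.ne).1 hy1
    refine ⟨y.toReal, (le_max_left _ _).trans hy1', ENNReal.ofReal_le_ofReal ?_⟩
    have h1 := hT' y.toReal ((le_max_right _ _).trans hy1')
    rw [ENNReal.ofReal_toReal hy2.ne] at h1 ⊢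
    have h3 : 0 ≤ 2 * prim f a / ε := by positivity
    rw [le_div_iff₀ (by linarith)]
    have h4 : 2 * prim f a / ε ≤ prim w y := by linarith
    rw [div_le_iff₀ hε'] at h4
    nlinarith

end

/-! ### Level intervals as chords -/

/-- A maximal level interval `(a, b)`, with ratio `m`, in terms of chords. -/
structure IsMaxChord (α : ℝ≥0∞) (w f : ℝ → ℝ) (a b : ℝ≥0∞) (m : ℝ) : Prop where
  isChord : IsChord α (prim w) (prim f) (ratio w f 0 ∞).toReal a b m
  left : IsContact α (prim w) (prim f) (ratio w f 0 ∞).toReal a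
  right : IsContact α (prim w) (prim f) (ratio w f 0 ∞).toReal b

/-- The slope function `f⁰ / w`. -/
noncomputable def slopeFun (α : ℝ≥0∞) (w f : ℝ → ℝ) (t : ℝ) : ℝ :=
  (levelFun α w f t / ENNReal.ofReal (w t)).toReal

theorem volume_ival_ofReal {s t : ℝ} (hs : 0 ≤ s) :
    volume (ival (ENNReal.ofReal s) (ENNReal.ofReal t)) = ENNReal.ofReal (t - s) := by
  rw [ival_eq_Ioo hs, Real.volume_Ioo]

section

variable {α : ℝ≥0∞} {w f h : ℝ → ℝ} {a b c d : ℝ≥0∞} {m m' t : ℝ}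

/-- This bound and the next replace differentiation of the primitives, and they use the values of
`h` at given points rather than almost everywhere. -/
theorem HasPrim.sub_le_mul (hh : HasPrim α h) (hanti : AntitoneOn h (ival 0 α))
    (h0 : ∀ t ∈ ival 0 α, 0 ≤ h t) {s t : ℝ} (hs : s ∈ ival 0 α) (hst : s ≤ t)
    (ht : ENNReal.ofReal t ≤ α) :
    prim h (ENNReal.ofReal t) - prim h (ENNReal.ofReal s) ≤ h s * (t - s) := by
  have hs0 := (pos_of_mem_ival hs).le
  have e := hh.integ_eq (ENNReal.ofReal_le_ofReal hst) ht ENNReal.ofReal_lt_top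
  have h1 : integ h (ENNReal.ofReal s) (ENNReal.ofReal t) ≤ ENNReal.ofReal (h s * (t - s)) := by
    rw [ENNReal.ofReal_mul (h0 s hs), ← volume_ival_ofReal hs0, ← setLIntegral_const]
    refine setLIntegral_mono' (measurableSet_ival _ _) fun x hx => ENNReal.ofReal_le_ofReal ?_
    refine hanti hs (ival_subset_ival zero_le ht hx) ?_
    exact (ENNReal.ofReal_lt_ofReal_iff'.1 hx.1).1.le
  rw [e] at h1
  exact (ENNReal.ofReal_le_ofReal_iff (mul_nonneg (h0 s hs) (sub_nonneg.2 hst))).1 h1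

theorem HasPrim.mul_le_sub (hh : HasPrim α h) (hanti : AntitoneOn h (ival 0 α))
    (h0 : ∀ t ∈ ival 0 α, 0 ≤ h t) {s t : ℝ} (ht : t ∈ ival 0 α) (hs : 0 ≤ s) (hst : s ≤ t) :
    h t * (t - s) ≤ prim h (ENNReal.ofReal t) - prim h (ENNReal.ofReal s) := by
  have e := hh.integ_eq (ENNReal.ofReal_le_ofReal hst) ht.2.le ENNReal.ofReal_lt_top
  have h1 : ENNReal.ofReal (h t * (t - s)) ≤ integ h (ENNReal.ofReal s) (ENNReal.ofReal t) := by
    rw [ENNReal.ofReal_mul (h0 t ht), ← volume_ival_ofReal hs, ← setLIntegral_const]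
    refine setLIntegral_mono' (measurableSet_ival _ _) fun x hx => ENNReal.ofReal_le_ofReal ?_
    refine hanti (ival_subset_ival zero_le ht.2.le hx) ht ?_
    exact (ENNReal.ofReal_lt_ofReal_iff'.1 hx.2).1.le
  rw [e] at h1
  refine (ENNReal.ofReal_le_ofReal_iff ?_).1 h1
  exact sub_nonneg.2 (hh.monotoneOn ⟨(ENNReal.ofReal_le_ofReal hst).trans ht.2.le,
    ENNReal.ofReal_lt_top⟩ ⟨ht.2.le, ENNReal.ofReal_lt_top⟩ (ENNReal.ofReal_le_ofReal hst))

theorem IsAdmissible.ratio_of_isChord (hA : IsAdmissible α w f)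
    (hc : IsChord α (prim w) (prim f) (ratio w f 0 ∞).toReal a b m) :
    ratio w f a b = ENNReal.ofReal m := by
  rcases eq_or_ne b ∞ with rfl | hb
  · rw [hA.ratio_top_eq (top_le_iff.1 hc.le) hc.lt, hc.eq_top rfl]
  · have hb := lt_top_iff_ne_top.2 hb
    rw [hA.ratio_of_lt_top hc.lt hc.le hb]
    have h1 := hc.eq hb
    have h2 := hA.primitivePair.lt_of_lt hc.lt hc.le hb
    congr 1
    rw [div_eq_iff (by linarith)]
    linarith

theorem IsAdmissible.isLevelInterval_of_isChord (hA : IsAdmissible α w f)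
    (hc : IsChord α (prim w) (prim f) (ratio w f 0 ∞).toReal a b m) :
    IsLevelInterval α w f a b := by
  have hr := hA.ratio_of_isChord hc
  refine ⟨hc.lt, hc.le, hr ▸ ENNReal.ofReal_pos.2 hc.pos, fun t hat htb => ?_⟩
  have ht : t < ∞ := htb.trans_le le_top
  rw [hr, hA.ratio_of_lt_top hat (htb.le.trans hc.le) ht]
  refine ENNReal.ofReal_le_ofReal ?_
  have h1 := hc.below t hat.le htb.le ht
  have h2 := hA.primitivePair.lt_of_lt hat (htb.le.trans hc.le) ht
  rw [div_le_iff₀ (by linarith)]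
  linarith

theorem IsAdmissible.isChord_of_isLevelInterval (hA : IsAdmissible α w f)
    (hl : IsLevelInterval α w f a b) :
    ∃ m, IsChord α (prim w) (prim f) (ratio w f 0 ∞).toReal a b m := by
  obtain ⟨hab, hb, hpos, hle⟩ := hl
  have hbelow : ∀ m, 0 < m → ratio w f a b = ENNReal.ofReal m → ∀ s, a < s → s < b →
      prim f s - m * prim w s ≤ prim f a - m * prim w a := by
    intro m hm hr s has hsb
    have hs : s < ∞ := hsb.trans_le le_top
    have h1 := hle s has hsb
    rw [hr, hA.ratio_of_lt_top has (hsb.le.trans hb) hs, ENNReal.ofReal_le_ofReal_iff hm.le,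
      div_le_iff₀ (sub_pos.2 (hA.primitivePair.lt_of_lt has (hsb.le.trans hb) hs))] at h1
    linarith
  rcases eq_or_ne b ∞ with rfl | hbt
  · have hr := hA.ratio_top_eq (top_le_iff.1 hb) hab
    have hρ : 0 < (ratio w f 0 ∞).toReal := by rwa [hr, ENNReal.ofReal_pos] at hpos
    refine ⟨_, hab, hb, hρ, fun s has _ hs => ?_, fun h => absurd rfl h.ne, fun _ => rfl⟩
    rcases has.eq_or_lt with rfl | has
    · exact le_rfl
    · exact hbelow _ hρ hr s has hs
  · have hbt := lt_top_iff_ne_top.2 hbt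
    have hr := hA.ratio_of_lt_top hab hb hbt
    have h2 := hA.primitivePair.lt_of_lt hab hb hbt
    set m := (prim f b - prim f a) / (prim w b - prim w a) with hm
    have hm0 : 0 < m := by rwa [hr, ENNReal.ofReal_pos] at hpos
    have heq : prim f b - m * prim w b = prim f a - m * prim w a := by
      have : prim f b - prim f a = m * (prim w b - prim w a) := by
        rw [hm, div_mul_cancel₀ _ (sub_pos.2 h2).ne']
      linarith
    refine ⟨m, hab, hb, hm0, fun s has hsb hs => ?_, fun _ => heq, fun h => absurd h hbt.ne⟩
    rcases has.eq_or_lt with rfl | has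
    · exact le_rfl
    rcases hsb.eq_or_lt with rfl | hsb
    · exact heq.le
    · exact hbelow _ hm0 hr s has hsb

theorem IsMaxChord.le_left (h : IsMaxChord α w f a b m) {p : ℝ≥0∞}
    (hp : IsContact α (prim w) (prim f) (ratio w f 0 ∞).toReal p) (hpb : p < b) : p ≤ a := by
  by_contra! hlt
  exact hp _ _ _ h.isChord hlt hpb

theorem IsMaxChord.right_le (h : IsMaxChord α w f a b m) {p : ℝ≥0∞}
    (hp : IsContact α (prim w) (prim f) (ratio w f 0 ∞).toReal p) (hap : a < p) : b ≤ p := by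
  by_contra! hlt
  exact hp _ _ _ h.isChord hap hlt

theorem IsMaxChord.eq_of_mem (h : IsMaxChord α w f a b m) (h' : IsMaxChord α w f c d m')
    {p : ℝ≥0∞} (h1 : a < p) (h2 : p < b) (h3 : c < p) (h4 : p < d) : c = a ∧ d = b :=
  ⟨le_antisymm (h.le_left h'.left (h3.trans h2)) (h'.le_left h.left (h1.trans h4)),
    le_antisymm (h'.right_le h.right (h3.trans h2)) (h.right_le h'.right (h1.trans h4))⟩

/-- A level interval lies inside a chord with contact endpoints, since no chord passes over a
contact point; maximality forces equality. Conversely, a strictly larger level interval would be a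
chord passing over one of the contact endpoints. -/
theorem IsAdmissible.isMaxLevelInterval_iff (hA : IsAdmissible α w f) :
    IsMaxLevelInterval α w f a b ↔ ∃ m, IsMaxChord α w f a b m := by
  constructor
  · rintro ⟨hl, hmax⟩
    obtain ⟨m, hc⟩ := hA.isChord_of_isLevelInterval hl
    obtain ⟨p, hap, hpb⟩ := exists_between hc.lt
    have hp : ¬ IsContact α (prim w) (prim f) (ratio w f 0 ∞).toReal p :=
      fun hp => hp _ _ _ hc hap hpb
    obtain ⟨a', b', m', hc', h1, h2, ha', hb'⟩ :=
      exists_isChord_of_not_isContact hA.primitivePair hp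
    have haa : a' ≤ a := by
      by_contra! hlt
      exact ha' _ _ _ hc hlt (h1.trans hpb)
    have hbb : b ≤ b' := by
      by_contra! hlt
      exact hb' _ _ _ hc (hap.trans h2) hlt
    obtain ⟨rfl, rfl⟩ := hmax a' b' (hA.isLevelInterval_of_isChord hc') haa hbb
    exact ⟨m', hc', ha', hb'⟩
  · rintro ⟨m, hc⟩
    refine ⟨hA.isLevelInterval_of_isChord hc.isChord, fun a' b' hl ha hb => ?_⟩
    obtain ⟨m', hc'⟩ := hA.isChord_of_isLevelInterval hl
    constructor
    · by_contra hne
      exact hc.left _ _ _ hc' (lt_of_le_of_ne ha hne) (hc.isChord.lt.trans_le hb)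
    · by_contra hne
      exact hc.right _ _ _ hc' (ha.trans_lt hc.isChord.lt) (lt_of_le_of_ne hb (Ne.symm hne))

theorem IsAdmissible.isContact_or_exists (hA : IsAdmissible α w f) (p : ℝ≥0∞) :
    IsContact α (prim w) (prim f) (ratio w f 0 ∞).toReal p ∨
      ∃ a b m, IsMaxChord α w f a b m ∧ a < p ∧ p < b := by
  by_cases hp : IsContact α (prim w) (prim f) (ratio w f 0 ∞).toReal p
  · exact Or.inl hp
  · obtain ⟨a, b, m, hc, h1, h2, h3, h4⟩ := exists_isChord_of_not_isContact hA.primitivePair hp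
    exact Or.inr ⟨a, b, m, ⟨hc, h3, h4⟩, h1, h2⟩

theorem IsMaxChord.not_isContact (h : IsMaxChord α w f a b m) {p : ℝ≥0∞} (h1 : a < p)
    (h2 : p < b) : ¬ IsContact α (prim w) (prim f) (ratio w f 0 ∞).toReal p :=
  fun hp => hp _ _ _ h.isChord h1 h2

/-- Maximal chords over a common point coincide, so the choice made in the definitions of the level
functions is forced. -/
theorem IsAdmissible.exists_choose (hA : IsAdmissible α w f) (h : IsMaxChord α w f a b m)
    (ht : t ∈ ival a b) : ∃ hex : ∃ p, InMaxLevelInterval α w f t p,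
      hex.choose.1 = a ∧ hex.choose.2 = b := by
  have hex : ∃ p, InMaxLevelInterval α w f t p :=
    ⟨(a, b), hA.isMaxLevelInterval_iff.2 ⟨m, h⟩, ht⟩
  refine ⟨hex, ?_⟩
  obtain ⟨h1, h2⟩ := hex.choose_spec
  obtain ⟨m', h'⟩ := hA.isMaxLevelInterval_iff.1 h1
  exact h.eq_of_mem h' ht.1 ht.2 h2.1 h2.2

theorem IsAdmissible.not_exists_of_isContact (hA : IsAdmissible α w f)
    (hp : IsContact α (prim w) (prim f) (ratio w f 0 ∞).toReal (ENNReal.ofReal t)) :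
    ¬ ∃ p, InMaxLevelInterval α w f t p := by
  rintro ⟨p, h1, h2⟩
  obtain ⟨m', h'⟩ := hA.isMaxLevelInterval_iff.1 h1
  exact h'.not_isContact h2.1 h2.2 hp

theorem IsAdmissible.levelFun_of_isMaxChord (hA : IsAdmissible α w f)
    (h : IsMaxChord α w f a b m) (ht : t ∈ ival a b) :
    levelFun α w f t = ENNReal.ofReal m * ENNReal.ofReal (w t) := by
  obtain ⟨hex, h1, h2⟩ := hA.exists_choose h ht
  rw [levelFun, dif_pos hex, h1, h2, hA.ratio_of_isChord h.isChord]

theorem IsAdmissible.invLevelFun_of_isMaxChord (hA : IsAdmissible α w f)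
    (h : IsMaxChord α w f a b m) (ht : t ∈ ival a b) :
    invLevelFun α w f t = ENNReal.ofReal (f t / m) := by
  obtain ⟨hex, h1, h2⟩ := hA.exists_choose h ht
  rw [invLevelFun, dif_pos hex, h1, h2, hA.ratio_of_isChord h.isChord,
    ENNReal.ofReal_div_of_pos h.isChord.pos]

theorem IsAdmissible.levelFun_of_isContact (hA : IsAdmissible α w f)
    (hp : IsContact α (prim w) (prim f) (ratio w f 0 ∞).toReal (ENNReal.ofReal t)) :
    levelFun α w f t = ENNReal.ofReal (f t) := by
  rw [levelFun, dif_neg (hA.not_exists_of_isContact hp)]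

theorem IsAdmissible.invLevelFun_of_isContact (hA : IsAdmissible α w f)
    (hp : IsContact α (prim w) (prim f) (ratio w f 0 ∞).toReal (ENNReal.ofReal t)) :
    invLevelFun α w f t = ENNReal.ofReal (w t) := by
  rw [invLevelFun, dif_neg (hA.not_exists_of_isContact hp)]

theorem slopeFun_nonneg (t : ℝ) : 0 ≤ slopeFun α w f t := ENNReal.toReal_nonneg

theorem IsMaxChord.mem (h : IsMaxChord α w f a b m) (ht : t ∈ ival a b) : t ∈ ival 0 α :=
  ival_subset_ival zero_le h.isChord.le ht

theorem IsAdmissible.slopeFun_of_isMaxChord (hA : IsAdmissible α w f)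
    (h : IsMaxChord α w f a b m) (ht : t ∈ ival a b) : slopeFun α w f t = m := by
  rw [slopeFun, hA.levelFun_of_isMaxChord h ht,
    ENNReal.mul_div_cancel_right (ENNReal.ofReal_pos.2 (hA.weight.pos t (h.mem ht))).ne'
      ENNReal.ofReal_ne_top, ENNReal.toReal_ofReal h.isChord.pos.le]

theorem IsAdmissible.slopeFun_of_isContact (hA : IsAdmissible α w f) (ht : t ∈ ival 0 α)
    (hp : IsContact α (prim w) (prim f) (ratio w f 0 ∞).toReal (ENNReal.ofReal t)) :
    slopeFun α w f t = f t / w t := by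
  have hw := hA.weight.pos t ht
  rw [slopeFun, hA.levelFun_of_isContact hp, ← ENNReal.ofReal_div_of_pos hw,
    ENNReal.toReal_ofReal (div_nonneg (hA.nonneg t ht) hw.le)]

theorem IsAdmissible.levelFun_eq (hA : IsAdmissible α w f) (ht : t ∈ ival 0 α) :
    levelFun α w f t = ENNReal.ofReal (slopeFun α w f t) * ENNReal.ofReal (w t) := by
  rcases hA.isContact_or_exists (ENNReal.ofReal t) with hp | ⟨a, b, m, h, h1, h2⟩
  · have hw := hA.weight.pos t ht
    rw [hA.levelFun_of_isContact hp, hA.slopeFun_of_isContact ht hp,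
      ← ENNReal.ofReal_mul (div_nonneg (hA.nonneg t ht) hw.le), div_mul_cancel₀ _ hw.ne']
  · rw [hA.levelFun_of_isMaxChord h ⟨h1, h2⟩, hA.slopeFun_of_isMaxChord h ⟨h1, h2⟩]

/-! ### Monotonicity of `f⁰ / w` and of `w^f` -/

/-- To the right of the contact point `p`, the slopes are at most those of the chords
starting at `p`. -/
theorem IsAdmissible.slopeFun_le (hA : IsAdmissible α w f) {p : ℝ≥0∞}
    (hp : IsContact α (prim w) (prim f) (ratio w f 0 ∞).toReal p) (ht : t ∈ ival 0 α)
    (hpt : p ≤ ENNReal.ofReal t) (hcont : ContinuousAt f t)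
    (hm : ∀ q, p < q → q ≤ α → q < ∞ → prim f q - prim f p ≤ m * (prim w q - prim w p)) :
    slopeFun α w f t ≤ m := by
  have hP := hA.primitivePair
  have hpα : p < α := hpt.trans_lt ht.2
  have hpt' : p < ∞ := hpα.trans_le le_top
  have hm0 : 0 ≤ m := by
    obtain ⟨q, h1, h2⟩ := exists_between hpα
    have h3 := hm q h1 h2.le (h2.trans_le le_top)
    have h4 := hP.lt_of_lt h1 h2.le (h2.trans_le le_top)
    have h5 := hP.le_of_le h1.le h2.le (h2.trans_le le_top)
    by_contra! hneg
    nlinarith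
  have hpos := pos_of_mem_ival ht
  rcases hA.isContact_or_exists (ENNReal.ofReal t) with hT | ⟨a, b, m', h, h1, h2⟩
  -- Concavity at the contact point `t` transfers the slope bound `m` from chords starting at `p` to
  -- chords starting at `t`.
  · have hmt : ∀ q, ENNReal.ofReal t < q → q ≤ α → q < ∞ →
        prim f q - prim f (ENNReal.ofReal t) ≤ m * (prim w q - prim w (ENNReal.ofReal t)) := by
      intro q hq hqα hqt
      rcases hpt.eq_or_lt with rfl | hlt
      · exact hm q hq hqα hqt
      · have h1 := hT.concave hP hlt hq hqα hqt
        have h2 := hm _ hlt ht.2.le ENNReal.ofReal_lt_top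
        have h3 := hP.lt_of_lt hlt ht.2.le ENNReal.ofReal_lt_top
        have h4 := hP.lt_of_lt hq hqα hqt
        by_contra! hcon
        nlinarith
    have hw := hA.weight.pos t ht
    rw [hA.slopeFun_of_isContact ht hT, div_le_iff₀ hw]
    -- For `q ↓ t`: `f q (q - t) ≤ F q - F t ≤ m (W q - W t) ≤ m w t (q - t)`. Only continuity of
    -- `f` at `t` is needed, not that of `w`.
    refine le_of_tendsto (hcont.tendsto.mono_left (nhdsWithin_le_nhds (s := Set.Ioi t))) ?_
    have hI : ∀ᶠ q in 𝓝[>] t, q ∈ ival 0 α :=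
      nhdsWithin_le_nhds ((isOpen_ival 0 α).mem_nhds ht)
    filter_upwards [hI, self_mem_nhdsWithin] with q hq htq
    have htq : t < q := htq
    have h1 := hA.hasPrim.mul_le_sub hA.antitoneOn hA.nonneg hq hpos.le htq.le
    have h2 := hA.weight.hasPrim.sub_le_mul hA.weight.antitoneOn (fun s hs => (hA.weight.pos s hs).le)
      ht htq.le hq.2.le
    have h3 := hmt (ENNReal.ofReal q) ((ENNReal.ofReal_lt_ofReal_iff_of_nonneg hpos.le).2 htq)
      hq.2.le ENNReal.ofReal_lt_top
    have h4 := h1.trans (h3.trans (mul_le_mul_of_nonneg_left h2 hm0))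
    rw [← mul_assoc] at h4
    exact le_of_mul_le_mul_right h4 (sub_pos.2 htq)
  · rw [hA.slopeFun_of_isMaxChord h ⟨h1, h2⟩]
    have hpa : p ≤ a := h.le_left hp (hpt.trans_lt h2)
    have haα : a < α := h1.trans ht.2
    have hat : a < ∞ := haα.trans_le le_top
    have hma : ∀ q, a < q → q ≤ α → q < ∞ →
        prim f q - prim f a ≤ m * (prim w q - prim w a) := by
      intro q hq hqα hqt
      rcases hpa.eq_or_lt with rfl | hlt
      · exact hm q hq hqα hqt
      · have h1 := h.left.concave hP hlt hq hqα hqt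
        have h2 := hm _ hlt haα.le hat
        have h3 := hP.lt_of_lt hlt haα.le hat
        have h4 := hP.lt_of_lt hq hqα hqt
        by_contra! hcon
        nlinarith
    rcases eq_or_ne b ∞ with rfl | hb
    · rw [h.isChord.eq_top rfl]
      have hα : α = ∞ := top_le_iff.1 h.isChord.le
      -- On an unbounded interval the slope is `ρ`. If `m < ρ`, then `F` would exceed `c₁ W` with
      -- `c₁ > m` at arbitrarily large points, against the bound by a line of slope `m`.
      by_contra! hlt
      obtain ⟨c₁, hc₁, hc₁'⟩ := exists_between hlt
      obtain ⟨x, hx, hx'⟩ := hP.unbounded hα (|prim f a - m * prim w a| / (c₁ - m))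
      obtain ⟨q, hq1, hq2, hq3⟩ := hP.lower hα c₁ hc₁' (max x (ENNReal.ofReal t))
        (max_lt hx ENNReal.ofReal_lt_top)
      have e1 := hma q (h1.trans_le ((le_max_right _ _).trans hq1)) (hα ▸ le_top) hq2
      have e2 := hx' q ((le_max_left _ _).trans hq1) hq2
      rw [div_le_iff₀ (by linarith)] at e2
      have e3 := le_abs_self (prim f a - m * prim w a)
      linarith
    · have hb := lt_top_iff_ne_top.2 hb
      have e1 := hma b h.isChord.lt h.isChord.le hb
      have e2 := h.isChord.eq hb
      have e3 := hP.lt_of_lt h.isChord.lt h.isChord.le hb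
      by_contra! hcon
      nlinarith

/-- To the left of the contact point `p`, the slopes are at least those of the chords
starting at `p`. -/
theorem IsAdmissible.le_slopeFun (hA : IsAdmissible α w f) {p q : ℝ≥0∞}
    (hp : IsContact α (prim w) (prim f) (ratio w f 0 ∞).toReal p) (ht : t ∈ ival 0 α)
    (htp : ENNReal.ofReal t ≤ p) (hcont : ContinuousAt f t) (hpq : p < q) (hq : q ≤ α)
    (hq' : q < ∞) :
    prim f q - prim f p ≤ slopeFun α w f t * (prim w q - prim w p) := by
  have hP := hA.primitivePair
  have hpα : p < α := hpq.trans_le hq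
  have hpt' : p < ∞ := hpα.trans_le le_top
  have hpos := pos_of_mem_ival ht
  have hWq := hP.lt_of_lt hpq hq hq'
  rcases hA.isContact_or_exists (ENNReal.ofReal t) with hT | ⟨a, b, m', h, h1, h2⟩
  · have hw := hA.weight.pos t ht
    rw [hA.slopeFun_of_isContact ht hT]
    -- Concavity at `t` compares the chord to `q` with chords from points `s < t`; letting `s ↑ t`
    -- bounds its slope by `f t / w t`.
    have key : ∀ q, ENNReal.ofReal t < q → q ≤ α → q < ∞ →
        prim f q - prim f (ENNReal.ofReal t) ≤
          f t / w t * (prim w q - prim w (ENNReal.ofReal t)) := by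
      intro q hq hqα hqt
      have h4 := hP.lt_of_lt hq hqα hqt
      rw [div_mul_eq_mul_div, le_div_iff₀ hw]
      have hlim : Tendsto (fun s => f s * (prim w q - prim w (ENNReal.ofReal t))) (𝓝[<] t)
          (𝓝 (f t * (prim w q - prim w (ENNReal.ofReal t)))) :=
        (hcont.tendsto.mono_left (nhdsWithin_le_nhds (s := Set.Iio t))).mul_const _
      refine ge_of_tendsto hlim ?_
      have hI : ∀ᶠ q in 𝓝[<] t, q ∈ ival 0 α :=
        nhdsWithin_le_nhds ((isOpen_ival 0 α).mem_nhds ht)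
      filter_upwards [hI, self_mem_nhdsWithin] with s hs hst
      have hst : s < t := hst
      have hs0 := pos_of_mem_ival hs
      have hlt : ENNReal.ofReal s < ENNReal.ofReal t :=
        (ENNReal.ofReal_lt_ofReal_iff_of_nonneg hs0.le).2 hst
      have e1 := hT.concave hP hlt hq hqα hqt
      have e2 := hA.hasPrim.sub_le_mul hA.antitoneOn hA.nonneg hs hst.le ht.2.le
      have e3 := hA.weight.hasPrim.mul_le_sub hA.weight.antitoneOn
        (fun s hs => (hA.weight.pos s hs).le) ht hs0.le hst.le
      have e4 := hP.le_of_le hq.le hqα hqt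
      have e5 := (mul_le_mul_of_nonneg_left e3 (sub_nonneg.2 e4)).trans
        (e1.trans (mul_le_mul_of_nonneg_right e2 (sub_pos.2 h4).le))
      have e6 : 0 < t - s := sub_pos.2 hst
      refine le_of_mul_le_mul_right ?_ e6
      linarith
    rcases htp.eq_or_lt with rfl | hlt
    · exact key q hpq hq hq'
    · have e1 := hp.concave hP hlt hpq hq hq'
      have e2 := key p hlt hpα.le hpt'
      have e3 := hP.lt_of_lt hlt hpα.le hpt'
      by_contra! hcon
      nlinarith
  · rw [hA.slopeFun_of_isMaxChord h ⟨h1, h2⟩]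
    have hbp : b ≤ p := h.right_le hp (h1.trans_le htp)
    have hbt : b < ∞ := hbp.trans_lt hpt'
    have e1 := h.isChord.eq hbt
    have e2 := hP.lt_of_lt h.isChord.lt h.isChord.le hbt
    have key : ∀ q, b < q → q ≤ α → q < ∞ → prim f q - prim f b ≤ m' * (prim w q - prim w b) := by
      intro q hq hqα hqt
      have e3 := h.right.concave hP h.isChord.lt hq hqα hqt
      have e4 := hP.lt_of_lt hq hqα hqt
      by_contra! hcon
      nlinarith
    rcases hbp.eq_or_lt with rfl | hlt
    · exact key q hpq hq hq'
    · have e3 := hp.concave hP hlt hpq hq hq'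
      have e4 := key p hlt hpα.le hpt'
      have e5 := hP.lt_of_lt hlt hpα.le hpt'
      by_contra! hcon
      nlinarith

/-- Either both points lie in one maximal level interval, where the slope is constant, or a contact
point separates them: `t₁` itself or the right end of its interval. The slopes of chords starting
there lie between the two values. Discontinuities of `f` are excluded because at contact points the
slope depends on the pointwise value `f t`. -/
theorem IsAdmissible.slopeFun_antitoneOn (hA : IsAdmissible α w f) :
    AntitoneOn (slopeFun α w f) (ival 0 α \ {t ∈ ival 0 α | ¬ ContinuousAt f t}) := by
  intro t₁ ht₁ t₂ ht₂ h12
  have hc₁ : ContinuousAt f t₁ := by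
    by_contra h; exact ht₁.2 ⟨ht₁.1, h⟩
  have hc₂ : ContinuousAt f t₂ := by
    by_contra h; exact ht₂.2 ⟨ht₂.1, h⟩
  have h12' := ENNReal.ofReal_le_ofReal h12
  rcases hA.isContact_or_exists (ENNReal.ofReal t₁) with hT | ⟨a, b, m', h, h1, h2⟩
  · exact hA.slopeFun_le hT ht₂.1 h12' hc₂ fun q hq hqα hqt =>
      hA.le_slopeFun hT ht₁.1 le_rfl hc₁ hq hqα hqt
  · rcases lt_or_ge (ENNReal.ofReal t₂) b with hb | hb
    · rw [hA.slopeFun_of_isMaxChord h ⟨h1, h2⟩,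
        hA.slopeFun_of_isMaxChord h ⟨h1.trans_le h12', hb⟩]
    · exact hA.slopeFun_le h.right ht₂.1 hb hc₂ fun q hq hqα hqt =>
        hA.le_slopeFun h.right ht₁.1 h2.le hc₁ hq hqα hqt

theorem IsAdmissible.countable_not_continuousAt (hA : IsAdmissible α w f) :
    {t ∈ ival 0 α | ¬ ContinuousAt f t}.Countable := by
  refine Set.Countable.mono (fun t ht => ?_) hA.antitoneOn.countable_not_continuousWithinAt
  exact ⟨ht.1, fun h => ht.2 (h.continuousAt ((isOpen_ival 0 α).mem_nhds ht.1))⟩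

/-- Between `t` and `b` the curve climbs back to its chord, so `F` gains at least `m` times the gain
of `W`. The first gain is at most `f t (b - t)` and the second at least `w b (b - t)`. Thus `w^f`
does not jump up at `b`. -/
theorem IsMaxChord.mul_le_of_right_le (hA : IsAdmissible α w f) (h : IsMaxChord α w f a b m)
    (ht : t ∈ ival a b) {s : ℝ} (hs : s ∈ ival 0 α) (hbs : b ≤ ENNReal.ofReal s) :
    m * w s ≤ f t := by
  have hbt : b < ∞ := hbs.trans_lt ENNReal.ofReal_lt_top
  have htI := h.mem ht
  have ht0 := pos_of_mem_ival htI
  have hb : ENNReal.ofReal b.toReal = b := ENNReal.ofReal_toReal hbt.ne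
  have htb : t < b.toReal := by
    rw [← ENNReal.ofReal_lt_ofReal_iff_of_nonneg ht0.le, hb]; exact ht.2
  have hbI : b.toReal ∈ ival 0 α := by
    rw [mem_ival, hb]; exact ⟨zero_le.trans_lt h.isChord.lt, hbs.trans_lt hs.2⟩
  have e1 := hA.hasPrim.sub_le_mul hA.antitoneOn hA.nonneg htI htb.le (hb.trans_le h.isChord.le)
  have e2 := hA.weight.hasPrim.mul_le_sub hA.weight.antitoneOn
    (fun s hs => (hA.weight.pos s hs).le) hbI ht0.le htb.le
  rw [hb] at e1 e2
  have e3 := h.isChord.below _ ht.1.le ht.2.le ENNReal.ofReal_lt_top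
  have e4 := h.isChord.eq hbt
  have e5 : w s ≤ w b.toReal :=
    hA.weight.antitoneOn hbI hs (ENNReal.toReal_le_of_le_ofReal (pos_of_mem_ival hs).le hbs)
  have e6 : 0 < b.toReal - t := sub_pos.2 htb
  have e7 := mul_le_mul_of_nonneg_left e2 h.isChord.pos.le
  have e8 := mul_le_mul_of_nonneg_left e5 h.isChord.pos.le
  refine e8.trans (le_of_mul_le_mul_right ?_ e6)
  linarith

/-- The mirror argument at the left end: between `a` and `t` the curve falls below its chord or
stays on it, so `F` gains at most `m` times the gain of `W`. -/
theorem IsMaxChord.le_mul_of_le_left (hA : IsAdmissible α w f) (h : IsMaxChord α w f a b m)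
    (ht : t ∈ ival a b) {s : ℝ} (hs : s ∈ ival 0 α) (hsa : ENNReal.ofReal s ≤ a) :
    f t ≤ m * w s := by
  have hat : a < ∞ := h.isChord.lt.trans_le le_top
  have htI := h.mem ht
  have ht0 := pos_of_mem_ival htI
  have ha : ENNReal.ofReal a.toReal = a := ENNReal.ofReal_toReal hat.ne
  have hta : a.toReal < t := by
    rw [← ENNReal.ofReal_lt_ofReal_iff_of_nonneg ENNReal.toReal_nonneg, ha]; exact ht.1
  have haI : a.toReal ∈ ival 0 α := by
    rw [mem_ival, ha]; exact ⟨hs.1.trans_le hsa, ht.1.trans htI.2⟩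
  have e1 := hA.hasPrim.mul_le_sub hA.antitoneOn hA.nonneg htI ENNReal.toReal_nonneg hta.le
  have e2 := hA.weight.hasPrim.sub_le_mul hA.weight.antitoneOn
    (fun s hs => (hA.weight.pos s hs).le) haI hta.le htI.2.le
  rw [ha] at e1 e2
  have e3 := h.isChord.below _ ht.1.le ht.2.le ENNReal.ofReal_lt_top
  have e5 : w a.toReal ≤ w s :=
    hA.weight.antitoneOn hs haI ((ENNReal.ofReal_le_iff_le_toReal hat.ne).1 hsa)
  have e6 : 0 < t - a.toReal := sub_pos.2 hta
  have e7 := mul_le_mul_of_nonneg_left e2 h.isChord.pos.le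
  have e8 := mul_le_mul_of_nonneg_left e5 h.isChord.pos.le
  refine (le_of_mul_le_mul_right ?_ e6).trans e8
  linarith

theorem IsAdmissible.invLevelFun_toReal_of_isMaxChord (hA : IsAdmissible α w f)
    (h : IsMaxChord α w f a b m) (ht : t ∈ ival a b) :
    (invLevelFun α w f t).toReal = f t / m := by
  rw [hA.invLevelFun_of_isMaxChord h ht,
    ENNReal.toReal_ofReal (div_nonneg (hA.nonneg t (h.mem ht)) h.isChord.pos.le)]

theorem IsAdmissible.invLevelFun_toReal_of_isContact (hA : IsAdmissible α w f)
    (ht : t ∈ ival 0 α)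
    (hp : IsContact α (prim w) (prim f) (ratio w f 0 ∞).toReal (ENNReal.ofReal t)) :
    (invLevelFun α w f t).toReal = w t := by
  rw [hA.invLevelFun_of_isContact hp, ENNReal.toReal_ofReal (hA.weight.pos t ht).le]

theorem IsAdmissible.invLevelFun_antitoneOn (hA : IsAdmissible α w f) :
    AntitoneOn (fun t => (invLevelFun α w f t).toReal) (ival 0 α) := by
  intro t₁ ht₁ t₂ ht₂ h12
  dsimp only
  have h12' := ENNReal.ofReal_le_ofReal h12
  rcases hA.isContact_or_exists (ENNReal.ofReal t₁) with hT₁ | ⟨a, b, m, h, h1, h2⟩ <;>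
  rcases hA.isContact_or_exists (ENNReal.ofReal t₂) with hT₂ | ⟨c, d, m', h', h1', h2'⟩
  · rw [hA.invLevelFun_toReal_of_isContact ht₁ hT₁, hA.invLevelFun_toReal_of_isContact ht₂ hT₂]
    exact hA.weight.antitoneOn ht₁ ht₂ h12
  · rw [hA.invLevelFun_toReal_of_isContact ht₁ hT₁,
      hA.invLevelFun_toReal_of_isMaxChord h' ⟨h1', h2'⟩, div_le_iff₀ h'.isChord.pos, mul_comm]
    exact h'.le_mul_of_le_left hA ⟨h1', h2'⟩ ht₁ (h'.le_left hT₁ (h12'.trans_lt h2'))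
  · rw [hA.invLevelFun_toReal_of_isContact ht₂ hT₂,
      hA.invLevelFun_toReal_of_isMaxChord h ⟨h1, h2⟩, le_div_iff₀ h.isChord.pos, mul_comm]
    exact h.mul_le_of_right_le hA ⟨h1, h2⟩ ht₂ (h.right_le hT₂ (h1.trans_le h12'))
  · rcases lt_or_ge (ENNReal.ofReal t₂) b with hb | hb
    · rw [hA.invLevelFun_toReal_of_isMaxChord h ⟨h1, h2⟩,
        hA.invLevelFun_toReal_of_isMaxChord h ⟨h1.trans_le h12', hb⟩]
      exact div_le_div_of_nonneg_right (hA.antitoneOn ht₁ ht₂ h12) h.isChord.pos.le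
    -- For two different intervals, the value `w b` at the right end of the first separates the two
    -- values of `w^f`.
    · have hbc : b ≤ c := h'.le_left h.right (hb.trans_lt h2')
      have hbt : ENNReal.ofReal b.toReal = b :=
        ENNReal.ofReal_toReal (hb.trans_lt ENNReal.ofReal_lt_top).ne
      have hbI : b.toReal ∈ ival 0 α := by
        rw [mem_ival, hbt]; exact ⟨zero_le.trans_lt h.isChord.lt, hb.trans_lt ht₂.2⟩
      have e1 := h.mul_le_of_right_le hA ⟨h1, h2⟩ hbI hbt.ge
      have e2 := h'.le_mul_of_le_left hA ⟨h1', h2'⟩ hbI (hbt.trans_le hbc)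
      rw [hA.invLevelFun_toReal_of_isMaxChord h ⟨h1, h2⟩,
        hA.invLevelFun_toReal_of_isMaxChord h' ⟨h1', h2'⟩]
      refine le_trans (b := w b.toReal) ?_ ?_
      · rw [div_le_iff₀ h'.isChord.pos, mul_comm]; exact e2
      · rw [le_div_iff₀ h.isChord.pos, mul_comm]; exact e1

end

/-! ### Integrals over maximal level intervals -/

section

variable {α : ℝ≥0∞} {φ D w f g : ℝ → ℝ}

/-- To compare two integrals, it suffices to compare them on the maximal level intervals. -/
theorem IsAdmissible.lintegral_le_of_isMaxChord (hA : IsAdmissible α w f) {τ : ℝ≥0∞}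
    {p q : ℝ → ℝ≥0∞}
    (hc : ∀ t ∈ ival 0 τ, IsContact α (prim w) (prim f) (ratio w f 0 ∞).toReal
      (ENNReal.ofReal t) → p t ≤ q t)
    (hI : ∀ a b m, IsMaxChord α w f a b m → a < τ →
      ∫⁻ t in ival a (min b τ), p t ≤ ∫⁻ t in ival a (min b τ), q t) :
    ∫⁻ t in ival 0 τ, p t ≤ ∫⁻ t in ival 0 τ, q t := by
  set M : Set (ℝ≥0∞ × ℝ≥0∞) := {x | (∃ m, IsMaxChord α w f x.1 x.2 m) ∧ x.1 < τ} with hM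
  set s : ℝ≥0∞ × ℝ≥0∞ → Set ℝ := fun x => ival x.1 (min x.2 τ) with hs
  have hdisj : M.PairwiseDisjoint s := by
    rintro ⟨a, b⟩ ⟨⟨m, h⟩, -⟩ ⟨c, d⟩ ⟨⟨m', h'⟩, -⟩ hne
    rw [Function.onFun, Set.disjoint_left]
    intro t ht ht'
    obtain ⟨h1, h2⟩ := h.eq_of_mem h' ht.1 (ht.2.trans_le (min_le_left _ _)) ht'.1
      (ht'.2.trans_le (min_le_left _ _))
    exact hne (Prod.ext h1.symm h2.symm)
  have hcount : M.Countable := by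
    refine hdisj.countable_of_isOpen (fun x _ => isOpen_ival _ _) ?_
    rintro ⟨a, b⟩ ⟨⟨m, h⟩, hτ⟩
    exact nonempty_of_measure_ne_zero (volume_ival_pos (lt_min h.isChord.lt hτ)).ne'
  have hmeas : ∀ x ∈ M, MeasurableSet (s x) := fun x _ => measurableSet_ival _ _
  have hUm : MeasurableSet (⋃ x ∈ M, s x) := MeasurableSet.biUnion hcount hmeas
  have hUsub : (⋃ x ∈ M, s x) ⊆ ival 0 τ :=
    Set.iUnion₂_subset fun x _ => ival_subset_ival zero_le (min_le_right _ _)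
  rw [← lintegral_inter_add_sdiff p (ival 0 τ) hUm, ← lintegral_inter_add_sdiff q (ival 0 τ) hUm,
    Set.inter_eq_right.2 hUsub, lintegral_biUnion hcount hmeas hdisj,
    lintegral_biUnion hcount hmeas hdisj]
  refine add_le_add (ENNReal.tsum_le_tsum fun x => ?_) ?_
  · obtain ⟨⟨m, h⟩, hτ⟩ := x.2
    exact hI _ _ m h hτ
  · refine setLIntegral_mono' ((measurableSet_ival _ _).diff hUm) fun t ht => ?_
    rcases hA.isContact_or_exists (ENNReal.ofReal t) with hT | ⟨a, b, m, h, h1, h2⟩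
    · exact hc t ht.1 hT
    · exact absurd (Set.mem_biUnion (show (a, b) ∈ M from ⟨⟨m, h⟩, h1.trans ht.1.2⟩)
        (show t ∈ ival a (min b τ) from ⟨h1, lt_min h2 ht.1.2⟩)) ht.2

theorem lintegral_ofReal_div (f : ℝ → ℝ) {m : ℝ} (hm : 0 < m) (a b : ℝ≥0∞) :
    ∫⁻ t in ival a b, ENNReal.ofReal (f t / m) = ENNReal.ofReal m⁻¹ * integ f a b := by
  rw [integ, ← lintegral_const_mul' _ _ ENNReal.ofReal_ne_top]
  refine lintegral_congr fun t => ?_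
  rw [← ENNReal.ofReal_mul (inv_pos.2 hm).le, div_eq_inv_mul]

/-- For finite `b` this is the chord equation. For `b = ∞` both integrals are infinite: `W → ∞`, and
`F / W` has upper limit `m > 0`. -/
theorem IsMaxChord.integ_eq_mul (hA : IsAdmissible α w f) {a b : ℝ≥0∞} {m : ℝ}
    (h : IsMaxChord α w f a b m) : integ f a b = ENNReal.ofReal m * integ w a b := by
  have hP := hA.primitivePair
  rcases eq_or_ne b ∞ with rfl | hb
  · have hα : α = ∞ := top_le_iff.1 h.isChord.le
    have hat := h.isChord.lt
    have hf : integ f 0 ∞ = ∞ := by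
      by_contra hcon
      have hm := h.isChord.pos
      obtain ⟨x, hx, hx'⟩ := hP.unbounded hα ((integ f 0 ∞).toReal / (m / 2))
      obtain ⟨q, hq1, hq2, hq3⟩ := hP.lower hα (m / 2)
        (by rw [← h.isChord.eq_top rfl]; linarith) x hx
      have h1 := hx' q hq1 hq2
      rw [div_le_iff₀ (by linarith)] at h1
      have h2 : prim f q ≤ (integ f 0 ∞).toReal :=
        ENNReal.toReal_mono hcon (lintegral_mono_set (ival_subset_ival le_rfl le_top))
      linarith
    rw [integ_eq_top_of_le le_top (hA.hasPrim.lt_top a (hα ▸ le_top) hat).ne hf,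
      integ_eq_top_of_le le_top (hA.weight.hasPrim.lt_top a (hα ▸ le_top) hat).ne
        (hA.integ_top hα), ENNReal.mul_top (ENNReal.ofReal_pos.2 h.isChord.pos).ne']
  · have hb := lt_top_iff_ne_top.2 hb
    rw [hA.hasPrim.integ_eq h.isChord.lt.le h.isChord.le hb,
      hA.weight.hasPrim.integ_eq h.isChord.lt.le h.isChord.le hb,
      ← ENNReal.ofReal_mul h.isChord.pos.le]
    congr 1
    have := h.isChord.eq hb
    linarith

theorem persp_mul_self {m : ℝ} (hm : 0 ≤ m) {y : ℝ≥0∞} (hy : y ≠ ∞) :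
    persp φ (ENNReal.ofReal m * y) y = ENNReal.ofReal (φ m) * y := by
  rw [persp]
  split_ifs with h1 h2 h3
  · simp [h1]
  · simp [h1] at h2
  · rw [ENNReal.mul_div_cancel_right h1 hy] at h3
    exact absurd h3 ENNReal.ofReal_ne_top
  · rw [ENNReal.mul_div_cancel_right h1 hy, ENNReal.toReal_ofReal hm]

theorem IsAdmissible.persp_levelFun (hA : IsAdmissible α w f) {t : ℝ} (ht : t ∈ ival 0 α) :
    persp φ (levelFun α w f t) (ENNReal.ofReal (w t)) =
      ENNReal.ofReal (φ (slopeFun α w f t)) * ENNReal.ofReal (w t) := by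
  rw [hA.levelFun_eq ht, persp_mul_self (slopeFun_nonneg t) ENNReal.ofReal_ne_top]

theorem IsMaxChord.persp_invLevelFun (hA : IsAdmissible α w f) {a b : ℝ≥0∞} {m t : ℝ}
    (h : IsMaxChord α w f a b m) (ht : t ∈ ival a b) :
    persp φ (ENNReal.ofReal (f t)) (invLevelFun α w f t) =
      ENNReal.ofReal (φ m) * ENNReal.ofReal (f t / m) := by
  rw [hA.invLevelFun_of_isMaxChord h ht, ← persp_mul_self h.isChord.pos.le ENNReal.ofReal_ne_top,
    ← ENNReal.ofReal_mul h.isChord.pos.le, mul_div_cancel₀ _ h.isChord.pos.ne']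

/-- The integrands agree at contact points. On a maximal level interval they are `φ(m) w` and `φ(m)
f / m`, whose integrals agree because `∫ f = m ∫ w`. -/
theorem IsAdmissible.lintegral_persp_eq (hA : IsAdmissible α w f) :
    ∫⁻ t in ival 0 α, persp φ (levelFun α w f t) (ENNReal.ofReal (w t)) =
      ∫⁻ t in ival 0 α, persp φ (ENNReal.ofReal (f t)) (invLevelFun α w f t) := by
  have key : ∀ a b m, IsMaxChord α w f a b m →
      ∫⁻ t in ival a (min b α), persp φ (levelFun α w f t) (ENNReal.ofReal (w t)) =
        ∫⁻ t in ival a (min b α), persp φ (ENNReal.ofReal (f t)) (invLevelFun α w f t) := by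
    intro a b m h
    rw [min_eq_left h.isChord.le]
    have e1 : ∫⁻ t in ival a b, persp φ (levelFun α w f t) (ENNReal.ofReal (w t)) =
        ∫⁻ t in ival a b, ENNReal.ofReal (φ m) * ENNReal.ofReal (w t) :=
      setLIntegral_congr_fun (measurableSet_ival _ _) fun t ht => by
        rw [hA.persp_levelFun (h.mem ht), hA.slopeFun_of_isMaxChord h ht]
    have e2 : ∫⁻ t in ival a b, persp φ (ENNReal.ofReal (f t)) (invLevelFun α w f t) =
        ∫⁻ t in ival a b, ENNReal.ofReal (φ m) * ENNReal.ofReal (f t / m) :=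
      setLIntegral_congr_fun (measurableSet_ival _ _) fun t ht => h.persp_invLevelFun hA ht
    rw [e1, e2, lintegral_const_mul' _ _ ENNReal.ofReal_ne_top,
      lintegral_const_mul' _ _ ENNReal.ofReal_ne_top, lintegral_ofReal_div f h.isChord.pos,
      h.integ_eq_mul hA, ← mul_assoc (ENNReal.ofReal m⁻¹),
      ← ENNReal.ofReal_mul (inv_pos.2 h.isChord.pos).le, inv_mul_cancel₀ h.isChord.pos.ne',
      ENNReal.ofReal_one, one_mul, integ]
  have hcon : ∀ t, IsContact α (prim w) (prim f) (ratio w f 0 ∞).toReal (ENNReal.ofReal t) →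
      persp φ (levelFun α w f t) (ENNReal.ofReal (w t)) =
        persp φ (ENNReal.ofReal (f t)) (invLevelFun α w f t) := fun t ht => by
    rw [hA.levelFun_of_isContact ht, hA.invLevelFun_of_isContact ht]
  exact le_antisymm
    (hA.lintegral_le_of_isMaxChord (fun t _ ht => (hcon t ht).le) fun a b m h _ => (key a b m h).le)
    (hA.lintegral_le_of_isMaxChord (fun t _ ht => (hcon t ht).ge) fun a b m h _ => (key a b m h).ge)

/-- An interval cut off at `t` contributes `(F c - F a) / m`, at most `W c - W a` because the curve
is below its chord. -/
theorem IsAdmissible.lintegral_invLevelFun_le (hA : IsAdmissible α w f) {t : ℝ≥0∞} (ht : t < α) :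
    ∫⁻ s in ival 0 t, ENNReal.ofReal (invLevelFun α w f s).toReal ≤ integ w 0 t := by
  refine hA.lintegral_le_of_isMaxChord (fun s hs hS => ?_) fun a b m h hat => ?_
  · rw [hA.invLevelFun_toReal_of_isContact (ival_subset_ival le_rfl ht.le hs) hS]
  · set c := min b t with hc
    have hac : a < c := lt_min h.isChord.lt hat
    have hcα : c ≤ α := (min_le_right _ _).trans ht.le
    have hct : c < ∞ := (min_le_right b t).trans_lt (ht.trans_le le_top)
    have e : ∫⁻ s in ival a c, ENNReal.ofReal (invLevelFun α w f s).toReal =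
        ∫⁻ s in ival a c, ENNReal.ofReal (f s / m) :=
      setLIntegral_congr_fun (measurableSet_ival _ _) fun s hs => by
        rw [hA.invLevelFun_toReal_of_isMaxChord h (ival_subset_ival le_rfl (min_le_left _ _) hs)]
    rw [e, lintegral_ofReal_div f h.isChord.pos]
    change _ ≤ integ w a c
    rw [hA.hasPrim.integ_eq hac.le hcα hct, hA.weight.hasPrim.integ_eq hac.le hcα hct,
      ← ENNReal.ofReal_mul (inv_pos.2 h.isChord.pos).le]
    refine ENNReal.ofReal_le_ofReal ?_
    rw [inv_mul_le_iff₀ h.isChord.pos]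
    have := h.isChord.below c hac.le (min_le_left _ _) hct
    linarith

theorem aemeasurable_of_antitoneOn_diff {τ : ℝ≥0∞} {h : ℝ → ℝ} {N : Set ℝ} (hN : N.Countable)
    (hh : AntitoneOn h (ival 0 τ \ N)) : AEMeasurable h (volume.restrict (ival 0 τ)) := by
  have := aemeasurable_restrict_of_antitoneOn (μ := volume)
    ((measurableSet_ival 0 τ).diff hN.measurableSet) hh
  rwa [Measure.restrict_congr_set (sdiff_null_ae_eq_self (hN.measure_zero volume))] at this

/-! ### The lower bound for the modular -/

/-- Young's inequality along a decreasing function `v`. -/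
theorem IsSubgradient.lintegral_le (hφ : IsNFunction φ) (hD : IsSubgradient φ D)
    (hw : IsWeight α w) (hg : MemL0 α g)
    (hgw : ∀ t ≤ α, ∫⁻ s in ival 0 t, ENNReal.ofReal |g s| ≤ integ w 0 t)
    {τ : ℝ≥0∞} (hτ : τ ≤ α) {v : ℝ → ℝ} {N : Set ℝ} (hN : N.Countable) (hv0 : ∀ t, 0 ≤ v t)
    (hv : AntitoneOn v (ival 0 τ \ N)) :
    ∫⁻ t in ival 0 τ, ENNReal.ofReal (D (v t)) * ENNReal.ofReal (f t) ≤
      (∫⁻ t in ival 0 τ, persp φ (ENNReal.ofReal (f t)) (ENNReal.ofReal |g t|)) +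
        ∫⁻ t in ival 0 τ, ENNReal.ofReal (w t) * ENNReal.ofReal (v t * D (v t) - φ (v t)) := by
  have hψ : AntitoneOn (fun t => v t * D (v t) - φ (v t)) (ival 0 τ \ N) :=
    fun s hs t ht hst => hD.conj_monotone (hv0 t) (hv hs ht hst)
  have hψm := aemeasurable_of_antitoneOn_diff hN hψ
  have hmono : volume.restrict (ival 0 τ) ≤ volume.restrict (ival 0 α) :=
    Measure.restrict_mono (ival_subset_ival le_rfl hτ) le_rfl
  have hgm : AEMeasurable (fun t => ENNReal.ofReal |g t|) (volume.restrict (ival 0 τ)) :=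
    (AEMeasurable.mono_measure hg hmono).abs.ennreal_ofReal
  have hwm : AEMeasurable (fun t => ENNReal.ofReal (w t)) (volume.restrict (ival 0 τ)) :=
    (AEMeasurable.mono_measure hw.memL0 hmono).ennreal_ofReal
  -- The conjugate term decreases along `v`, so Hardy's lemma may replace `|g|` by `w` in it.
  have hardy := lintegral_mul_le_of_antitoneOn hgm hwm (fun t ht => hgw t (ht.trans hτ))
    (hN.measure_zero volume) (fun t => hD.conj_nonneg hφ (hv0 t)) hψm hψ
  refine le_trans ?_ (add_le_add_right hardy _)
  have hgψ : AEMeasurable (fun t => ENNReal.ofReal |g t| *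
      ENNReal.ofReal (v t * D (v t) - φ (v t))) (volume.restrict (ival 0 τ)) :=
    hgm.mul hψm.ennreal_ofReal
  rw [← lintegral_add_right' _ hgψ]
  refine lintegral_mono fun t => ?_
  have := hD.mul_le_persp hφ (hv0 t) (ENNReal.ofReal (f t)) (y := ENNReal.ofReal |g t|)
    ENNReal.ofReal_ne_top
  rwa [mul_comm (ENNReal.ofReal (v t * D (v t) - φ (v t)))] at this

/-- Young's inequality is applied to the slope truncated at `n`. Truncation, together with `τ < ∞`,
makes the conjugate term finite, so that it cancels from both sides. -/
theorem IsAdmissible.lintegral_min_le (hA : IsAdmissible α w f) (hφ : IsNFunction φ)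
    (hg : MemL0 α g)
    (hgw : ∀ t ≤ α, ∫⁻ s in ival 0 t, ENNReal.ofReal |g s| ≤ integ w 0 t)
    {τ : ℝ≥0∞} (hτα : τ ≤ α) (hτt : τ < ∞)
    (hτ : IsContact α (prim w) (prim f) (ratio w f 0 ∞).toReal τ) (n : ℕ) :
    ∫⁻ t in ival 0 τ, ENNReal.ofReal (w t) * ENNReal.ofReal (φ (min (slopeFun α w f t) n)) ≤
      ∫⁻ t in ival 0 τ, persp φ (ENNReal.ofReal (f t)) (ENNReal.ofReal |g t|) := by
  obtain ⟨D, hD⟩ := hφ.exists_isSubgradient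
  set v : ℝ → ℝ := fun t => min (slopeFun α w f t) n with hv
  have hn : (0 : ℝ) ≤ n := Nat.cast_nonneg n
  have hv0 : ∀ t, 0 ≤ v t := fun t => le_min (slopeFun_nonneg t) hn
  have hsub : ival 0 τ \ {t ∈ ival 0 α | ¬ ContinuousAt f t} ⊆
      ival 0 α \ {t ∈ ival 0 α | ¬ ContinuousAt f t} :=
    Set.sdiff_subset_sdiff_left (ival_subset_ival le_rfl hτα)
  have hvanti : AntitoneOn v (ival 0 τ \ {t ∈ ival 0 α | ¬ ContinuousAt f t}) :=
    fun s hs t ht hst => min_le_min_right _ (hA.slopeFun_antitoneOn (hsub hs) (hsub ht) hst)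
  have hψanti : AntitoneOn (fun t => v t * D (v t) - φ (v t))
      (ival 0 τ \ {t ∈ ival 0 α | ¬ ContinuousAt f t}) :=
    fun s hs t ht hst => hD.conj_monotone (hv0 t) (hvanti hs ht hst)
  have hψm := aemeasurable_of_antitoneOn_diff hA.countable_not_continuousAt hψanti
  have hwm : AEMeasurable (fun t => ENNReal.ofReal (w t)) (volume.restrict (ival 0 τ)) :=
    (AEMeasurable.mono_measure hA.weight.memL0
      (Measure.restrict_mono (ival_subset_ival le_rfl hτα) le_rfl)).ennreal_ofReal
  have young := hD.lintegral_le (f := f) hφ hA.weight hg hgw hτα hA.countable_not_continuousAt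
    hv0 hvanti
  have hfin : ∫⁻ t in ival 0 τ, ENNReal.ofReal (w t) *
      ENNReal.ofReal (v t * D (v t) - φ (v t)) ≠ ∞ := by
    have hle : ∫⁻ t in ival 0 τ, ENNReal.ofReal (w t) *
        ENNReal.ofReal (v t * D (v t) - φ (v t)) ≤
        ∫⁻ t in ival 0 τ, ENNReal.ofReal (w t) * ENNReal.ofReal (n * D n - φ n) :=
      lintegral_mono fun t => mul_le_mul_right
        (ENNReal.ofReal_le_ofReal (hD.conj_monotone (hv0 t) (min_le_right _ _))) _
    refine (hle.trans_lt ?_).ne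
    rw [lintegral_mul_const' _ _ ENNReal.ofReal_ne_top]
    exact ENNReal.mul_lt_top (hA.weight.hasPrim.lt_top τ hτα hτt) ENNReal.ofReal_lt_top
  have hadd : ∀ t, ENNReal.ofReal (w t) * ENNReal.ofReal (φ (v t)) +
      ENNReal.ofReal (w t) * ENNReal.ofReal (v t * D (v t) - φ (v t)) =
      ENNReal.ofReal (v t * D (v t)) * ENNReal.ofReal (w t) := fun t => by
    rw [← mul_add, ← ENNReal.ofReal_add (hφ.nonneg (hv0 t)) (hD.conj_nonneg hφ (hv0 t)),
      add_sub_cancel, mul_comm]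
  -- The left side is `∫ v D(v) w`. At contact points `v w ≤ f`; on a maximal level interval `v =
  -- min m n` is constant and `∫ f = m ∫ w`. As `τ` is a contact point, it cuts no such interval.
  have hlow : (∫⁻ t in ival 0 τ, ENNReal.ofReal (w t) * ENNReal.ofReal (φ (v t))) +
      (∫⁻ t in ival 0 τ, ENNReal.ofReal (w t) * ENNReal.ofReal (v t * D (v t) - φ (v t))) ≤
      ∫⁻ t in ival 0 τ, ENNReal.ofReal (D (v t)) * ENNReal.ofReal (f t) := by
    have hwψ : AEMeasurable (fun t => ENNReal.ofReal (w t) *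
        ENNReal.ofReal (v t * D (v t) - φ (v t))) (volume.restrict (ival 0 τ)) :=
      hwm.mul hψm.ennreal_ofReal
    rw [← lintegral_add_right' _ hwψ, lintegral_congr hadd]
    refine hA.lintegral_le_of_isMaxChord (fun t ht hT => ?_) fun a b m h haτ => ?_
    · have htI := ival_subset_ival le_rfl hτα ht
      have hw := hA.weight.pos t htI
      have hDv := hD.nonneg _ (hv0 t)
      rw [← ENNReal.ofReal_mul (mul_nonneg (hv0 t) hDv), ← ENNReal.ofReal_mul hDv]
      refine ENNReal.ofReal_le_ofReal ?_
      have e : v t ≤ f t / w t := hA.slopeFun_of_isContact htI hT ▸ min_le_left _ _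
      rw [le_div_iff₀ hw] at e
      have := mul_le_mul_of_nonneg_left e hDv
      linarith
    · have hbτ : b ≤ τ := h.right_le hτ haτ
      rw [min_eq_left hbτ]
      have hvc : ∀ t ∈ ival a b, v t = min m n := fun t ht => by
        rw [hv]; dsimp only; rw [hA.slopeFun_of_isMaxChord h ht]
      have hm := h.isChord.pos.le
      have hDv := hD.nonneg _ (le_min hm hn)
      have e1 : ∫⁻ t in ival a b, ENNReal.ofReal (v t * D (v t)) * ENNReal.ofReal (w t) =
          ∫⁻ t in ival a b, ENNReal.ofReal (min m n * D (min m n)) * ENNReal.ofReal (w t) :=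
        setLIntegral_congr_fun (measurableSet_ival _ _) fun t ht => by rw [hvc t ht]
      have e2 : ∫⁻ t in ival a b, ENNReal.ofReal (D (v t)) * ENNReal.ofReal (f t) =
          ∫⁻ t in ival a b, ENNReal.ofReal (D (min m n)) * ENNReal.ofReal (f t) :=
        setLIntegral_congr_fun (measurableSet_ival _ _) fun t ht => by rw [hvc t ht]
      rw [e1, e2,
        lintegral_const_mul' _ _ ENNReal.ofReal_ne_top,
        lintegral_const_mul' _ _ ENNReal.ofReal_ne_top]
      change _ * integ w a b ≤ _ * integ f a b
      rw [h.integ_eq_mul hA, ← mul_assoc, ← ENNReal.ofReal_mul hDv, mul_comm (min m (n : ℝ))]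
      exact mul_le_mul_left (ENNReal.ofReal_le_ofReal
        (mul_le_mul_of_nonneg_left (min_le_left _ _) hDv)) _
  exact (ENNReal.add_le_add_iff_right hfin).1 (hlow.trans young)

theorem IsAdmissible.lintegral_slopeFun_le (hA : IsAdmissible α w f) (hφ : IsNFunction φ)
    (hg : MemL0 α g)
    (hgw : ∀ t ≤ α, ∫⁻ s in ival 0 t, ENNReal.ofReal |g s| ≤ integ w 0 t)
    {τ : ℝ≥0∞} (hτα : τ ≤ α) (hτt : τ < ∞)
    (hτ : IsContact α (prim w) (prim f) (ratio w f 0 ∞).toReal τ) :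
    ∫⁻ t in ival 0 τ, ENNReal.ofReal (w t) * ENNReal.ofReal (φ (slopeFun α w f t)) ≤
      ∫⁻ t in ival 0 τ, persp φ (ENNReal.ofReal (f t)) (ENNReal.ofReal |g t|) := by
  have hmin : ∀ (n : ℕ) t, 0 ≤ min (slopeFun α w f t) n :=
    fun n t => le_min (slopeFun_nonneg t) (Nat.cast_nonneg n)
  have hφmono : ∀ {x y : ℝ}, 0 ≤ x → x ≤ y → φ x ≤ φ y := fun hx hxy =>
    hφ.strictMonoOn.monotoneOn (Set.mem_Ici.2 hx) (Set.mem_Ici.2 (hx.trans hxy)) hxy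
  have hsub : ival 0 τ \ {t ∈ ival 0 α | ¬ ContinuousAt f t} ⊆
      ival 0 α \ {t ∈ ival 0 α | ¬ ContinuousAt f t} :=
    Set.sdiff_subset_sdiff_left (ival_subset_ival le_rfl hτα)
  have hm : ∀ n : ℕ, AEMeasurable (fun t => ENNReal.ofReal (w t) *
      ENNReal.ofReal (φ (min (slopeFun α w f t) n))) (volume.restrict (ival 0 τ)) := fun n => by
    refine AEMeasurable.mul ?_ (AEMeasurable.ennreal_ofReal ?_)
    · exact (AEMeasurable.mono_measure hA.weight.memL0
        (Measure.restrict_mono (ival_subset_ival le_rfl hτα) le_rfl)).ennreal_ofReal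
    · refine aemeasurable_of_antitoneOn_diff hA.countable_not_continuousAt fun s hs t ht hst => ?_
      exact hφmono (hmin n t)
        (min_le_min_right _ (hA.slopeFun_antitoneOn (hsub hs) (hsub ht) hst))
  calc ∫⁻ t in ival 0 τ, ENNReal.ofReal (w t) * ENNReal.ofReal (φ (slopeFun α w f t))
      ≤ ∫⁻ t in ival 0 τ, ⨆ n : ℕ, ENNReal.ofReal (w t) *
          ENNReal.ofReal (φ (min (slopeFun α w f t) n)) := by
        refine lintegral_mono fun t => ?_
        obtain ⟨n, hn⟩ := exists_nat_ge (slopeFun α w f t)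
        refine le_trans (le_of_eq ?_) (le_iSup _ n)
        rw [min_eq_left hn]
    _ = ⨆ n : ℕ, ∫⁻ t in ival 0 τ, ENNReal.ofReal (w t) *
          ENNReal.ofReal (φ (min (slopeFun α w f t) n)) := by
        refine lintegral_iSup' hm (Eventually.of_forall fun t i j hij => ?_)
        exact mul_le_mul_right (ENNReal.ofReal_le_ofReal (hφmono (hmin i t)
          (min_le_min_left _ (Nat.cast_le.2 hij)))) _
    _ ≤ _ := iSup_le fun n => hA.lintegral_min_le hφ hg hgw hτα hτt hτ n

/-- If the integral had a finite value `P`, Young's inequality with the constant `v = m` would give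
`D(m) F ≤ P + (m D(m) - φ(m)) W`. Dividing by `W` and passing to the upper limit `m` of `F / W`
contradicts `φ(m) > 0`. -/
theorem IsMaxChord.lintegral_persp_eq_top (hA : IsAdmissible α w f) (hφ : IsNFunction φ)
    (hg : MemL0 α g)
    (hgw : ∀ t ≤ α, ∫⁻ s in ival 0 t, ENNReal.ofReal |g s| ≤ integ w 0 t)
    {a : ℝ≥0∞} {m : ℝ} (h : IsMaxChord α w f a ∞ m) :
    ∫⁻ t in ival 0 α, persp φ (ENNReal.ofReal (f t)) (ENNReal.ofReal |g t|) = ∞ := by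
  by_contra hcon
  set P := ∫⁻ t in ival 0 α, persp φ (ENNReal.ofReal (f t)) (ENNReal.ofReal |g t|) with hPdef
  have hP := hA.primitivePair
  obtain ⟨D, hD⟩ := hφ.exists_isSubgradient
  have hα : α = ∞ := top_le_iff.1 h.isChord.le
  have hm := h.isChord.pos
  have hφm := hφ.pos hm
  have hψ := hD.conj_nonneg hφ hm.le
  have hDm : 0 < D m := by
    by_contra! hneg
    nlinarith
  have key : ∀ τ < ∞, D m * prim f τ ≤ P.toReal + (m * D m - φ m) * prim w τ := by
    intro τ hτ
    have hτα : τ ≤ α := hα ▸ le_top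
    have e := hD.lintegral_le (f := f) hφ hA.weight hg hgw hτα Set.countable_empty
      (v := fun _ => m) (fun _ => hm.le) (fun _ _ _ _ _ => le_rfl)
    rw [lintegral_const_mul' _ _ ENNReal.ofReal_ne_top,
      lintegral_mul_const' _ _ ENNReal.ofReal_ne_top] at e
    change _ * integ f 0 τ ≤ _ + integ w 0 τ * _ at e
    have e' := e.trans (add_le_add_left
      (lintegral_mono_set (ival_subset_ival le_rfl hτα) : _ ≤ P) _)
    have hw := (hA.weight.hasPrim.lt_top τ hτα hτ).ne
    have e2 := ENNReal.toReal_mono (ENNReal.add_ne_top.2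
      ⟨hcon, ENNReal.mul_ne_top hw ENNReal.ofReal_ne_top⟩) e'
    rw [ENNReal.toReal_add hcon (ENNReal.mul_ne_top hw ENNReal.ofReal_ne_top), ENNReal.toReal_mul,
      ENNReal.toReal_mul, ENNReal.toReal_ofReal hDm.le, ENNReal.toReal_ofReal hψ,
      mul_comm (integ w 0 τ).toReal] at e2
    exact e2
  obtain ⟨x, hx, hx'⟩ := hP.unbounded hα ((P.toReal + 1) / (φ m / 2))
  -- Multiplied by `D m`, this slope loses only half of `φ m`; the other half gives `(φ m / 2) W q ≤
  -- P`, while `x` was chosen to make the left side at least `P + 1`.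
  obtain ⟨q, hq1, hq2, hq3⟩ := hP.lower hα (m - φ m / (2 * D m)) (by
    rw [← h.isChord.eq_top rfl]; have : 0 < φ m / (2 * D m) := by positivity
    linarith) x hx
  have e1 := key q hq2
  have e2 := hx' q hq1 hq2
  rw [div_le_iff₀ (by linarith)] at e2
  have e3 := mul_lt_mul_of_pos_left hq3 hDm
  have e4 : D m * ((m - φ m / (2 * D m)) * prim w q) =
      (m * D m - φ m / 2) * prim w q := by
    field_simp
  linarith

theorem IsAdmissible.lintegral_levelFun_le (hA : IsAdmissible α w f) (hφ : IsNFunction φ)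
    (hg : MemL0 α g)
    (hgw : ∀ t ≤ α, ∫⁻ s in ival 0 t, ENNReal.ofReal |g s| ≤ integ w 0 t) :
    ∫⁻ t in ival 0 α, persp φ (levelFun α w f t) (ENNReal.ofReal (w t)) ≤
      ∫⁻ t in ival 0 α, persp φ (ENNReal.ofReal (f t)) (ENNReal.ofReal |g t|) := by
  by_cases hex : ∃ a m, IsMaxChord α w f a ∞ m
  · obtain ⟨a, m, h⟩ := hex
    rw [h.lintegral_persp_eq_top hA hφ hg hgw]
    exact le_top
  push Not at hex
  rw [setLIntegral_congr_fun (measurableSet_ival _ _) (g := fun t =>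
    ENNReal.ofReal (w t) * ENNReal.ofReal (φ (slopeFun α w f t)))
    fun t ht => by rw [hA.persp_levelFun ht, mul_comm]]
  refine lintegral_ival_le_of_forall_lt fun t ht => ?_
  -- With every maximal level interval bounded, a finite contact point lies at or beyond `t`: either
  -- `t` or the right end of its interval.
  obtain ⟨τ, htτ, hτα, hτt, hτ⟩ : ∃ τ, t ≤ τ ∧ τ ≤ α ∧ τ < ∞ ∧
      IsContact α (prim w) (prim f) (ratio w f 0 ∞).toReal τ := by
    rcases hA.isContact_or_exists t with hT | ⟨a, b, m, h, h1, h2⟩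
    · exact ⟨t, le_rfl, ht.le, ht.trans_le le_top, hT⟩
    · exact ⟨b, h2.le, h.isChord.le, lt_top_iff_ne_top.2 fun hb => hex a m (hb ▸ h), h.right⟩
  exact (lintegral_mono_set (ival_subset_ival le_rfl htτ)).trans
    ((hA.lintegral_slopeFun_le hφ hg hgw hτα hτt hτ).trans
      (lintegral_mono_set (ival_subset_ival le_rfl hτα)))

end

/-! ### Submajorization and membership in `M_{φ,w}` -/

section

variable {α : ℝ≥0∞} {φ w f f' g : ℝ → ℝ}

theorem ne_top_of_antitone_of_lintegral_lt_top {p : ℝ → ℝ≥0∞} (hp : Antitone p)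
    (h : ∀ t < α, ∫⁻ s in ival 0 t, p s < ∞) {x : ℝ} (hx : x ∈ ival 0 α) : p x ≠ ∞ := by
  intro hcon
  have h1 : ∫⁻ s in ival 0 (ENNReal.ofReal x), p s = ∞ := by
    have : ∫⁻ s in ival 0 (ENNReal.ofReal x), p s =
        ∫⁻ _ in ival 0 (ENNReal.ofReal x), (∞ : ℝ≥0∞) :=
      setLIntegral_congr_fun (measurableSet_ival _ _) fun s hs =>
        top_le_iff.1 (hcon.symm.le.trans (hp (ENNReal.ofReal_lt_ofReal_iff'.1 hs.2).1.le))
    rw [this, setLIntegral_const, volume_ival_zero, ENNReal.top_mul hx.1.ne']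
  exact (h _ hx.2).ne h1

theorem IsWeight.rearr_le (hw : IsWeight α w) {t : ℝ} (ht : t ∈ ival 0 α) :
    rearr α w t ≤ ENNReal.ofReal (w t) :=
  rearr_le_of_antitoneOn hw.antitoneOn (fun s hs => (hw.pos s hs).le) ht

theorem Submaj.lintegral_rearr_le (hw : IsWeight α w) (hgw : Submaj α g w) {t : ℝ≥0∞}
    (ht : t < α) : ∫⁻ s in ival 0 t, rearr α g s ≤ integ w 0 t :=
  (hgw t ht).trans (setLIntegral_mono' (measurableSet_ival _ _) fun _ hs =>
    hw.rearr_le (ival_subset_ival le_rfl ht.le hs))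

/-- The integral of `|g|` over an initial interval is at most that of `g*`, which is finite at every
point of `I` because its integrals are dominated by those of `w`. -/
theorem Submaj.lintegral_le (hw : IsWeight α w) (hg : MemL0 α g) (hgw : Submaj α g w) {t : ℝ≥0∞}
    (ht : t ≤ α) : ∫⁻ s in ival 0 t, ENNReal.ofReal |g s| ≤ integ w 0 t := by
  refine lintegral_ival_le_of_forall_lt fun t' ht' => ?_
  have htα := ht'.trans_le ht
  refine (lintegral_le_lintegral_rearr hg htα.le fun x hx => ?_).trans
    ((hgw.lintegral_rearr_le hw htα).trans (lintegral_mono_set (ival_subset_ival le_rfl ht'.le)))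
  exact ne_top_of_antitone_of_lintegral_lt_top (rearr_antitone α g)
    (fun s hs => (hgw.lintegral_rearr_le hw hs).trans_lt (hw.integ_lt_top s hs))
    (ival_subset_ival le_rfl htα.le hx)

theorem submaj_of_antitoneOn (hw : IsWeight α w) (hg : AntitoneOn g (ival 0 α))
    (hg0 : ∀ t ∈ ival 0 α, 0 ≤ g t)
    (hgw : ∀ t < α, ∫⁻ s in ival 0 t, ENNReal.ofReal (g s) ≤ integ w 0 t) : Submaj α g w := by
  intro t ht
  have hI := ival_subset_ival (le_refl (0 : ℝ≥0∞)) ht.le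
  calc ∫⁻ s in ival 0 t, rearr α g s
      ≤ ∫⁻ s in ival 0 t, ENNReal.ofReal (g s) :=
        setLIntegral_mono' (measurableSet_ival _ _) fun s hs =>
          rearr_le_of_antitoneOn hg hg0 (hI hs)
    _ ≤ integ w 0 t := hgw t ht
    _ = ∫⁻ s in ival 0 t, ENNReal.ofReal |w s| :=
        setLIntegral_congr_fun (measurableSet_ival _ _) fun s hs => by
          rw [abs_of_pos (hw.pos s (hI hs))]
    _ ≤ ∫⁻ s in ival 0 t, rearr α w s :=
        lintegral_le_lintegral_rearr hw.memL0 ht.le fun s hs =>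
          ((hw.rearr_le (hI hs)).trans_lt ENNReal.ofReal_lt_top).ne

/-- The primitive of `f*` is dominated by that of `w` if `f` belongs to the space generated by
the modular. -/
theorem MemM.exists_bound (hφ : IsNFunction φ) (hw : IsWeight α w) (hf : MemM α φ w f) :
    ∃ A B : ℝ, ∀ t < α, ∫⁻ s in ival 0 t, rearr α f s ≤
      ENNReal.ofReal A + ENNReal.ofReal B * integ w 0 t := by
  obtain ⟨-, c, hc, hP⟩ := hf
  obtain ⟨g, hP⟩ := iInf_lt_iff.1 hP
  obtain ⟨⟨hg, hgw⟩, hP⟩ := iInf_lt_iff.1 hP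
  obtain ⟨D, hD⟩ := hφ.exists_isSubgradient
  set P := ∫⁻ t in ival 0 α, persp φ (rearr α (fun t => f t / c) t) (ENNReal.ofReal |g t|)
  have hD1 : 0 < D 1 := by
    have h1 := hD.conj_nonneg hφ zero_le_one
    have h2 := hφ.pos one_pos
    linarith
  have hD0 : ENNReal.ofReal (D 1) ≠ 0 := (ENNReal.ofReal_pos.2 hD1).ne'
  -- Young's inequality with the constant `v = 1` bounds `D 1 ∫ (f/c)*` by `P + (D 1 - φ 1) W`. The
  -- constants come from dividing by `D 1` and rescaling by `c`.
  refine ⟨c * (P.toReal / D 1), c * ((1 * D 1 - φ 1) / D 1), fun t ht => ?_⟩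
  have hmono : volume.restrict (ival 0 t) ≤ volume.restrict (ival 0 α) :=
    Measure.restrict_mono (ival_subset_ival le_rfl ht.le) le_rfl
  have hgm : AEMeasurable (fun s => ENNReal.ofReal (1 * D 1 - φ 1) * ENNReal.ofReal |g s|)
      (volume.restrict (ival 0 t)) :=
    (AEMeasurable.mono_measure hg hmono).abs.ennreal_ofReal.const_mul _
  have e1 : ENNReal.ofReal (D 1) * ∫⁻ s in ival 0 t, rearr α (fun t => f t / c) s ≤
      P + ENNReal.ofReal (1 * D 1 - φ 1) * integ w 0 t := by
    rw [← lintegral_const_mul' _ _ ENNReal.ofReal_ne_top]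
    calc ∫⁻ s in ival 0 t, ENNReal.ofReal (D 1) * rearr α (fun t => f t / c) s
        ≤ ∫⁻ s in ival 0 t, (persp φ (rearr α (fun t => f t / c) s) (ENNReal.ofReal |g s|) +
            ENNReal.ofReal (1 * D 1 - φ 1) * ENNReal.ofReal |g s|) :=
          lintegral_mono fun s => hD.mul_le_persp hφ zero_le_one _ ENNReal.ofReal_ne_top
      _ = (∫⁻ s in ival 0 t, persp φ (rearr α (fun t => f t / c) s) (ENNReal.ofReal |g s|)) +
            ENNReal.ofReal (1 * D 1 - φ 1) * ∫⁻ s in ival 0 t, ENNReal.ofReal |g s| := by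
          rw [lintegral_add_right' _ hgm, lintegral_const_mul' _ _ ENNReal.ofReal_ne_top]
      _ ≤ _ := add_le_add (lintegral_mono_set (ival_subset_ival le_rfl ht.le))
          (mul_le_mul_right (hgw.lintegral_le hw hg ht.le) _)
  have e2 : ∫⁻ s in ival 0 t, rearr α (fun t => f t / c) s ≤
      ENNReal.ofReal (P.toReal / D 1) + ENNReal.ofReal ((1 * D 1 - φ 1) / D 1) * integ w 0 t := by
    rw [ENNReal.ofReal_div_of_pos hD1, ENNReal.ofReal_div_of_pos hD1, ENNReal.ofReal_toReal hP.ne,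
      ENNReal.mul_div_right_comm.symm, ← ENNReal.add_div,
      ENNReal.le_div_iff_mul_le (Or.inl hD0) (Or.inl ENNReal.ofReal_ne_top), mul_comm]
    exact e1
  calc ∫⁻ s in ival 0 t, rearr α f s
      ≤ ∫⁻ s in ival 0 t, ENNReal.ofReal c * rearr α (fun t => f t / c) s :=
        lintegral_mono fun s => rearr_le_mul_rearr_div f hc s
    _ = ENNReal.ofReal c * ∫⁻ s in ival 0 t, rearr α (fun t => f t / c) s :=
        lintegral_const_mul' _ _ ENNReal.ofReal_ne_top
    _ ≤ _ := by
        rw [ENNReal.ofReal_mul hc.le, ENNReal.ofReal_mul hc.le, mul_assoc, ← mul_add]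
        exact mul_le_mul_right e2 _

theorem MemM.rearr_ne_top (hφ : IsNFunction φ) (hw : IsWeight α w) (hf : MemM α φ w f) {x : ℝ}
    (hx : x ∈ ival 0 α) : rearr α f x ≠ ∞ := by
  obtain ⟨A, B, hAB⟩ := hf.exists_bound hφ hw
  exact ne_top_of_antitone_of_lintegral_lt_top (rearr_antitone α f) (fun t ht => (hAB t ht).trans_lt
    (ENNReal.add_lt_top.2 ⟨ENNReal.ofReal_lt_top,
      ENNReal.mul_lt_top ENNReal.ofReal_lt_top (hw.integ_lt_top t ht)⟩)) hx

/-- Working with `f*` gives a representative that is decreasing at every point of `I`, while `f`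
itself is so only almost everywhere. -/
theorem MemM.isAdmissible (hφ : IsNFunction φ) (hw : IsWeight α w)
    (hW : α = ∞ → integ w 0 ∞ = ∞) (hf : MemM α φ w f) :
    IsAdmissible α w (fun t => (rearr α f t).toReal) := by
  obtain ⟨A, B, hAB⟩ := hf.exists_bound hφ hw
  have hfin : ∀ t < α, ENNReal.ofReal A + ENNReal.ofReal B * integ w 0 t < ∞ := fun t ht =>
    ENNReal.add_lt_top.2 ⟨ENNReal.ofReal_lt_top,
      ENNReal.mul_lt_top ENNReal.ofReal_lt_top (hw.integ_lt_top t ht)⟩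
  have hle : ∀ t < α, integ (fun t => (rearr α f t).toReal) 0 t ≤
      ENNReal.ofReal A + ENNReal.ofReal B * integ w 0 t := fun t ht =>
    (lintegral_mono fun s => ENNReal.ofReal_toReal_le).trans (hAB t ht)
  refine ⟨hw, hW, fun s hs t _ hst => ENNReal.toReal_mono (hf.rearr_ne_top hφ hw hs)
    (rearr_antitone α f hst), fun t _ => ENNReal.toReal_nonneg,
    fun t ht => (hle t ht).trans_lt (hfin t ht), max A 0, max B 0, fun t ht => ?_⟩
  have h1 := ENNReal.toReal_mono (hfin t ht).ne (hle t ht)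
  rwa [ENNReal.toReal_add ENNReal.ofReal_ne_top
    (ENNReal.mul_ne_top ENNReal.ofReal_ne_top (hw.integ_lt_top t ht).ne), ENNReal.toReal_mul,
    ENNReal.toReal_ofReal', ENNReal.toReal_ofReal'] at h1

/-! ### Independence of the representative of `f` -/

theorem integ_congr_ae (h : ∀ᵐ t ∂volume.restrict (ival 0 α), f t = f' t) {a b : ℝ≥0∞}
    (hb : b ≤ α) : integ f a b = integ f' a b := by
  refine lintegral_congr_ae ?_
  filter_upwards [ae_restrict_of_ae_restrict_of_subset (ival_subset_ival zero_le hb) h] with t ht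
  rw [ht]

theorem ratio_congr_ae (h : ∀ᵐ t ∂volume.restrict (ival 0 α), f t = f' t) {a b : ℝ≥0∞}
    (hb : b ≤ α) : ratio w f a b = ratio w f' a b := by
  rw [ratio, ratio]
  split_ifs with hbt
  · subst hbt
    refine limsup_congr (Eventually.of_forall fun t => ?_)
    rw [integ_congr_ae h (le_top.trans hb)]
  · rw [integ_congr_ae h hb]

theorem isLevelInterval_congr_ae (h : ∀ᵐ t ∂volume.restrict (ival 0 α), f t = f' t)
    (a b : ℝ≥0∞) : IsLevelInterval α w f a b ↔ IsLevelInterval α w f' a b := by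
  unfold IsLevelInterval
  refine and_congr_right fun _ => and_congr_right fun hb => ?_
  rw [ratio_congr_ae h hb]
  refine and_congr_right fun _ => forall_congr' fun t => imp_congr_right fun _ =>
    imp_congr_right fun htb => ?_
  rw [ratio_congr_ae h (htb.le.trans hb)]

theorem inMaxLevelInterval_congr_ae (h : ∀ᵐ t ∂volume.restrict (ival 0 α), f t = f' t) (t : ℝ) :
    InMaxLevelInterval α w f t = InMaxLevelInterval α w f' t := by
  funext p
  simp only [InMaxLevelInterval, IsMaxLevelInterval, isLevelInterval_congr_ae h]

theorem ratio_choose_congr_ae (h : ∀ᵐ t ∂volume.restrict (ival 0 α), f t = f' t) {t : ℝ}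
    (hex : ∃ p, InMaxLevelInterval α w f t p) (hex' : ∃ p, InMaxLevelInterval α w f' t p) :
    ratio w f hex.choose.1 hex.choose.2 = ratio w f' hex'.choose.1 hex'.choose.2 := by
  -- Choice applied to equal predicates returns the same interval.
  have hc : ∀ {P Q : ℝ≥0∞ × ℝ≥0∞ → Prop} (_ : P = Q) (h : ∃ p, P p) (h' : ∃ p, Q p),
      h.choose = h'.choose := by
    rintro P _ rfl h h'
    rfl
  rw [ratio_congr_ae h hex.choose_spec.1.1.2.1, hc (inMaxLevelInterval_congr_ae h t) hex hex']

theorem levelFun_congr_ae (h : ∀ᵐ t ∂volume.restrict (ival 0 α), f t = f' t) {t : ℝ}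
    (ht : f t = f' t) : levelFun α w f t = levelFun α w f' t := by
  by_cases hex : ∃ p, InMaxLevelInterval α w f t p
  · have hex' : ∃ p, InMaxLevelInterval α w f' t p := inMaxLevelInterval_congr_ae h t ▸ hex
    rw [levelFun, levelFun, dif_pos hex, dif_pos hex', ratio_choose_congr_ae h hex hex']
  · have hex' : ¬ ∃ p, InMaxLevelInterval α w f' t p := inMaxLevelInterval_congr_ae h t ▸ hex
    rw [levelFun, levelFun, dif_neg hex, dif_neg hex', ht]

theorem invLevelFun_congr_ae (h : ∀ᵐ t ∂volume.restrict (ival 0 α), f t = f' t) {t : ℝ}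
    (ht : f t = f' t) : invLevelFun α w f t = invLevelFun α w f' t := by
  by_cases hex : ∃ p, InMaxLevelInterval α w f t p
  · have hex' : ∃ p, InMaxLevelInterval α w f' t p := inMaxLevelInterval_congr_ae h t ▸ hex
    rw [invLevelFun, invLevelFun, dif_pos hex, dif_pos hex', ratio_choose_congr_ae h hex hex', ht]
  · have hex' : ¬ ∃ p, InMaxLevelInterval α w f' t p := inMaxLevelInterval_congr_ae h t ▸ hex
    rw [invLevelFun, invLevelFun, dif_neg hex, dif_neg hex']

theorem IsAdmissible.invLevelFun_ne_top (hA : IsAdmissible α w f) (t : ℝ) :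
    invLevelFun α w f t ≠ ∞ := by
  rcases hA.isContact_or_exists (ENNReal.ofReal t) with hT | ⟨a, b, m, h, h1, h2⟩
  · rw [hA.invLevelFun_of_isContact hT]; exact ENNReal.ofReal_ne_top
  · rw [hA.invLevelFun_of_isMaxChord h ⟨h1, h2⟩]; exact ENNReal.ofReal_ne_top

/-! ### The modular as an attained infimum -/

/-- The infimum defining the modular is attained at the inverse level function of `f*`. -/
theorem modP_eq_lintegral (hφ : IsNFunction φ)
    (hA : IsAdmissible α w f') (hf' : ∀ t ∈ ival 0 α, rearr α f t = ENNReal.ofReal (f' t)) :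
    modP α φ w f =
      ∫⁻ t in ival 0 α, persp φ (ENNReal.ofReal (f' t)) (invLevelFun α w f' t) := by
  have hw := hA.weight
  have hrearr : ∀ g : ℝ → ℝ, ∫⁻ t in ival 0 α, persp φ (rearr α f t) (ENNReal.ofReal |g t|) =
      ∫⁻ t in ival 0 α, persp φ (ENNReal.ofReal (f' t)) (ENNReal.ofReal |g t|) := fun g =>
    setLIntegral_congr_fun (measurableSet_ival _ _) fun t ht => by rw [hf' t ht]
  refine le_antisymm ?_ ?_
  · have hanti := hA.invLevelFun_antitoneOn
    have hsub : Submaj α (fun t => (invLevelFun α w f' t).toReal) w :=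
      submaj_of_antitoneOn hw hanti (fun t _ => ENNReal.toReal_nonneg)
        fun t ht => hA.lintegral_invLevelFun_le ht
    have hmem : MemL0 α (fun t => (invLevelFun α w f' t).toReal) :=
      aemeasurable_restrict_of_antitoneOn (measurableSet_ival _ _) hanti
    refine (iInf₂_le _ (show _ ∈ {g : ℝ → ℝ | MemL0 α g ∧ Submaj α g w} from ⟨hmem, hsub⟩)).trans ?_
    rw [hrearr]
    refine (lintegral_congr fun t => ?_).le
    rw [abs_of_nonneg ENNReal.toReal_nonneg, ENNReal.ofReal_toReal (hA.invLevelFun_ne_top t)]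
  · refine le_iInf₂ fun g hg => ?_
    rw [hrearr, ← hA.lintegral_persp_eq]
    exact hA.lintegral_levelFun_le hφ hg.1 fun t ht => hg.2.lintegral_le hw hg.1 ht

end

end OrliczLorentz

theorem mainTheorem3 (α : ℝ≥0∞) (hα : 0 < α)
    (φ : ℝ → ℝ) (hφ : OrliczLorentz.IsNFunction φ)
    (w : ℝ → ℝ) (hw : OrliczLorentz.IsWeight α w)
    (hW : α = ∞ → OrliczLorentz.integ w 0 ∞ = ∞)
    (f : ℝ → ℝ) (hf : OrliczLorentz.MemM α φ w f)
    (hf_rearr : ∀ᵐ t ∂(volume.restrict (OrliczLorentz.ival 0 α)),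
      0 ≤ f t ∧ ENNReal.ofReal (f t) = OrliczLorentz.rearr α f t) :
    OrliczLorentz.modP α φ w f =
        ∫⁻ t in OrliczLorentz.ival 0 α,
          OrliczLorentz.persp φ (OrliczLorentz.levelFun α w f t) (ENNReal.ofReal (w t)) ∧
      OrliczLorentz.modP α φ w f =
        ∫⁻ t in OrliczLorentz.ival 0 α,
          OrliczLorentz.persp φ (ENNReal.ofReal (f t)) (OrliczLorentz.invLevelFun α w f t) := by
  have hA := hf.isAdmissible hφ hw hW
  have hae : ∀ᵐ t ∂volume.restrict (OrliczLorentz.ival 0 α),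
      f t = (OrliczLorentz.rearr α f t).toReal := by
    filter_upwards [hf_rearr] with t ht
    rw [← ht.2, ENNReal.toReal_ofReal ht.1]
  -- The theorem is proved for the representative `f*` and then transferred to `f`: the level
  -- intervals coincide, and the integrands agree almost everywhere.
  have key := OrliczLorentz.modP_eq_lintegral hφ hA fun t ht =>
    (ENNReal.ofReal_toReal (hf.rearr_ne_top hφ hw ht)).symm
  constructor
  · rw [key, ← hA.lintegral_persp_eq]
    refine lintegral_congr_ae ?_
    filter_upwards [hae] with t ht
    rw [OrliczLorentz.levelFun_congr_ae hae ht]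
  · rw [key]
    refine lintegral_congr_ae ?_
    filter_upwards [hae] with t ht
    rw [OrliczLorentz.invLevelFun_congr_ae hae ht, ← ht]
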